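/- Let $q:\mathbb{R}\to\mathbb{C}$ satisfy $$q\in L_1[0,\pi],\qquad \int_0^{\pi} q(x)\,dx=0,\qquad q(x+\pi)=q(x),\qquad \overline{q(-x)}=q(x)\quad\text{for a.e. }x .$$ Let $L(q)$ be the operator generated in $L_2(-\infty,\infty)$ by the differential expression $-y''+qy$ on its maximal domain (all $y\in L_2(\mathbb{R})$ such that $y,y'$ are locally absolutely continuous and $-y''+qy\in L_2(\mathbb{R})$), with spectrum $\sigma(L(q))$. For $t\in\{0,\pi\}$ let $L_t(q)$ be the operator generated in $L_2[0,\pi]$ by $-y''+qy$ and the boundary conditions $y(\pi)=e^{it}y(0)$, $y'(\pi)=e^{it}y'(0)$. Let $\mu_1(0),\mu_2(0),\dots$ be a numbering of the eigenvalues of $L_0(q)$ (the periodic eigenvalues), and $\mu_1(\pi),\mu_2(\pi),\dots$ a numbering of the eigenvalues of $L_\pi(q)$ (the antiperiodic eigenvalues); each eigenvalue is listed at least once, and repetitions, for instance according to multiplicity, are allowed. If there exists $m>0$ such that $\mu_n(0)$ and $\mu_n(\pi)$ are nonreal for all $n>m$, then there exists $R$ such that $[R,\infty)\subset\sigma(L(q))$,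 and the number of gaps in the real part $\sigma(L(q))\cap\mathbb{R}$ of the spectrum, that is, of connected components of $\mathbb{R}\setminus\sigma(L(q))$, is finite. -/

import Mathlib

open MeasureTheory

noncomputable section

/-- The complex Hilbert space `L₂(-∞, ∞)`. -/
abbrev L2R : Type := Lp ℂ 2 (volume : Measure ℝ)

/-- The graph of the operator `L(q)` generated in `L₂(-∞, ∞)` by the differential expression
`-y'' + q y` on its maximal domain: the pairs `(y, f)` in `L₂ × L₂` such that `y` has a
representative `u` which is differentiable with locally absolutely continuous derivative `v = u'`
and `-v' + q u = f` almost everywhere. -/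
def hillGraph (q : ℝ → ℂ) : Submodule ℂ (L2R × L2R) where
  carrier := {p | ∃ u v : ℝ → ℂ, (p.1 : ℝ → ℂ) =ᵐ[volume] u ∧
    (∀ x, HasDerivAt u (v x) x) ∧
    (∀ a b, AbsolutelyContinuousOnInterval v a b) ∧
    ∀ᵐ x, HasDerivAt v (q x * u x - (p.2 : ℝ → ℂ) x) x}
  zero_mem' := by
    refine ⟨fun _ => 0, fun _ => 0, Lp.coeFn_zero ℂ 2 volume, fun x => hasDerivAt_const x 0,
      fun a b => ?_, ?_⟩
    · exact (LipschitzWith.const (0 : ℂ)).lipschitzOnWith.absolutelyContinuousOnInterval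
    · filter_upwards [Lp.coeFn_zero ℂ 2 (volume : Measure ℝ)] with x hx
      have h : (((0 : L2R × L2R).2 : L2R) : ℝ → ℂ) x = 0 := hx
      rw [h]
      simpa using hasDerivAt_const x (0 : ℂ)
  add_mem' := by
    rintro p p' ⟨u, v, h1, h2, h3, h4⟩ ⟨u', v', h1', h2', h3', h4'⟩
    refine ⟨u + u', v + v', ?_, fun x => (h2 x).add (h2' x), fun a b => (h3 a b).add (h3' a b), ?_⟩
    · exact (Lp.coeFn_add p.1 p'.1).trans (h1.add h1')
    · filter_upwards [h4, h4', Lp.coeFn_add p.2 p'.2] with x hx hx' hs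
      have hs' : (((p + p').2 : L2R) : ℝ → ℂ) x = (p.2 : ℝ → ℂ) x + (p'.2 : ℝ → ℂ) x := hs
      rw [hs']
      have e : q x * (u + u') x - ((p.2 : ℝ → ℂ) x + (p'.2 : ℝ → ℂ) x) =
          q x * u x - (p.2 : ℝ → ℂ) x + (q x * u' x - (p'.2 : ℝ → ℂ) x) := by
        rw [Pi.add_apply]
        ring
      rw [e]
      exact hx.add hx'
  smul_mem' := by
    rintro c p ⟨u, v, h1, h2, h3, h4⟩
    refine ⟨c • u, c • v, ?_, fun x => (h2 x).const_smul c, fun a b => (h3 a b).const_smul c, ?_⟩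
    · exact (Lp.coeFn_smul c p.1).trans (h1.const_smul c)
    · filter_upwards [h4, Lp.coeFn_smul c p.2] with x hx hs
      have hs' : (((c • p).2 : L2R) : ℝ → ℂ) x = c * (p.2 : ℝ → ℂ) x := hs
      rw [hs']
      have e : q x * (c • u) x - c * (p.2 : ℝ → ℂ) x = c • (q x * u x - (p.2 : ℝ → ℂ) x) := by
        rw [Pi.smul_apply, smul_eq_mul, smul_eq_mul]
        ring
      rw [e]
      exact hx.const_smul c

/-- The graph of `L(q)` is single-valued. -/
theorem hillGraph_single_valued (q : ℝ → ℂ) (p : L2R × L2R) (hp : p ∈ hillGraph q)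
    (h0 : p.1 = 0) : p.2 = 0 := by
  obtain ⟨u, v, h1, h2, -, h4⟩ := hp
  have hu : u = fun _ => (0 : ℂ) := by
    have hc : Continuous u := continuous_iff_continuousAt.2 fun x => (h2 x).continuousAt
    have hae : u =ᵐ[volume] fun _ => (0 : ℂ) := by
      rw [h0] at h1
      exact h1.symm.trans (Lp.coeFn_zero ℂ 2 volume)
    exact (hc.ae_eq_iff_eq volume continuous_const).1 hae
  have hv : v = fun _ => (0 : ℂ) := by
    funext x
    have h := h2 x
    rw [hu] at h
    exact h.unique (hasDerivAt_const x (0 : ℂ))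
  refine Lp.ext ?_
  filter_upwards [h4, Lp.coeFn_zero ℂ 2 (volume : Measure ℝ)] with x hx hz
  rw [hu, hv] at hx
  have h := hx.unique (hasDerivAt_const x (0 : ℂ))
  rw [hz]
  simpa using h

/-- The operator `L(q)` in `L₂(-∞, ∞)`. -/
def hillOperator (q : ℝ → ℂ) : L2R →ₗ.[ℂ] L2R := (hillGraph q).toLinearPMap

/-- `L(q) y = f` holds exactly for the pairs `(y, f)` of `hillGraph q`. -/
theorem hillOperator_graph (q : ℝ → ℂ) : (hillOperator q).graph = hillGraph q :=
  Submodule.toLinearPMap_graph_eq _ (hillGraph_single_valued q)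

/-- The spectrum of an (in general unbounded) operator `T` in a complex normed space: the
complex numbers `z` for which `T - z`, from the domain of `T` to the whole space, has no bounded
everywhere defined two-sided inverse. -/
def unboundedSpectrum {E : Type*} [NormedAddCommGroup E] [NormedSpace ℂ E] (T : E →ₗ.[ℂ] E) :
    Set ℂ :=
  {z | ¬ ∃ S : E →L[ℂ] E,
    (∀ f : E, ∃ h : S f ∈ T.domain, T ⟨S f, h⟩ - z • S f = f) ∧
    ∀ y : T.domain, S (T y - z • (y : E)) = y}

/-- `z` is an eigenvalue of the operator `L_t(q)` generated in `L₂[0, π]` by `-y'' + q y` and the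
boundary conditions `y(π) = e^{it} y(0)`, `y'(π) = e^{it} y'(0)`: there is an eigenfunction `u`,
not identically zero on `[0, π]`, which is differentiable on `[0, π]` with absolutely continuous
derivative `v = u'`, fulfils the boundary conditions, and satisfies `-v' + q u = z u` almost
everywhere on `[0, π]`. -/
def IsBlochEigenvalue (q : ℝ → ℂ) (t : ℝ) (z : ℂ) : Prop :=
  ∃ u v : ℝ → ℂ,
    (∃ x ∈ Set.Icc 0 Real.pi, u x ≠ 0) ∧
    (∀ x ∈ Set.Icc 0 Real.pi, HasDerivWithinAt u (v x) (Set.Icc 0 Real.pi) x) ∧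
    AbsolutelyContinuousOnInterval v 0 Real.pi ∧
    (∀ᵐ x ∂volume.restrict (Set.Icc 0 Real.pi), HasDerivAt v (q x * u x - z * u x) x) ∧
    u Real.pi = Complex.exp (Complex.I * t) * u 0 ∧
    v Real.pi = Complex.exp (Complex.I * t) * v 0

/-- The real part `σ(L(q)) ∩ ℝ` of the spectrum of `L(q)`. -/
def realSpectrum (q : ℝ → ℂ) : Set ℝ :=
  {x | (x : ℂ) ∈ unboundedSpectrum (hillOperator q)}

/-- The gaps of a set `S` of real numbers: the connected components of `ℝ \ S` (unbounded
components included). -/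
def gaps (S : Set ℝ) : Set (Set ℝ) :=
  {G | ∃ x ∈ Sᶜ, G = connectedComponentIn Sᶜ x}

end

/-! The proof is Floquet theory for a single function, the discriminant `Δ = hillDiscriminant q`,
the trace of the monodromy matrix over one period. Since `q` is only integrable, the equation is
rewritten for `(y, y' - Q y)` with `Q` the primitive of `q`. The new coefficients are continuous,
and they are periodic, hence bounded, because `q` has mean zero. Classical ODE theory then applies.

The monodromy matrix has determinant 1, so the Floquet multipliers are the roots of `ρ² - Δρ + 1`. A
unimodular multiplier puts `z` in the spectrum: cutting off a bounded Floquet solution gives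
approximate eigenfunctions (`mem_spectrum_of_unimodular`). A multiplier with `|ρ| < 1` puts `z` in
the resolvent set, by an exponentially decaying Green's function (`notMem_spectrum_of_multiplier`).
The symmetry of `q` makes `Δ` real on the real line (`hillDiscriminant_im`), so the real spectrum is
exactly `{|Δ| ≤ 2}`.

Real points with `Δ = 2` or `Δ = -2` are periodic or antiperiodic eigenvalues, and by hypothesis
there are finitely many of them. Moreover `Δ(k²) = 2 cos(πk) + O(1/k)`
(`norm_hillDiscriminant_sub_le`), so `Δ(n²)` has the sign of `(-1)^n` for large `n`. Past the last
point with `|Δ| = 2`, a value outside `(-2, 2)` would force another crossing of `±2` by the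
intermediate value theorem, so `|Δ| < 2` there and a half-line lies in the spectrum. The gaps are
the components of `{|Δ| > 2}`, which is bounded above. Each is determined by its supremum, where
`|Δ| = 2`, so there are finitely many. -/

noncomputable section

/-! ### Absolutely continuous complex functions -/

theorem AbsolutelyContinuousOnInterval.ofReal_comp {g : ℝ → ℝ} {a b : ℝ}
    (hg : AbsolutelyContinuousOnInterval g a b) :
    AbsolutelyContinuousOnInterval (fun x => (g x : ℂ)) a b := by
  have hd : ∀ x y : ℝ, dist (x : ℂ) (y : ℂ) = dist x y := fun x y => by
    rw [Complex.dist_eq, ← Complex.ofReal_sub, Complex.norm_real, Real.dist_eq, Real.norm_eq_abs]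
  simpa only [AbsolutelyContinuousOnInterval, hd] using hg

theorem absolutelyContinuousOnInterval_integral_complex {f : ℝ → ℂ}
    (hf : ∀ a b, IntervalIntegrable f volume a b) (c a b : ℝ) :
    AbsolutelyContinuousOnInterval (fun x => ∫ t in c..x, f t) a b := by
  have hre : ∀ a b, IntervalIntegrable (fun x => (f x).re) volume a b := fun a b =>
    ⟨(hf a b).1.re, (hf a b).2.re⟩
  have him : ∀ a b, IntervalIntegrable (fun x => (f x).im) volume a b := fun a b =>
    ⟨(hf a b).1.im, (hf a b).2.im⟩
  have key : ∀ g : ℝ → ℝ, (∀ a b, IntervalIntegrable g volume a b) →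
      AbsolutelyContinuousOnInterval (fun x => ∫ t in c..x, g t) a b := by
    intro g hg
    -- The base point `c` may lie outside the interval from `a` to `b`, so the interval is first
    -- enlarged to contain it.
    have h1 : AbsolutelyContinuousOnInterval (fun x => ∫ t in c..x, g t)
        (min c (min a b)) (max c (max a b)) := by
      refine (hg _ _).absolutelyContinuousOnInterval_intervalIntegral ?_
      rw [Set.uIcc_of_le (le_trans (min_le_left c (min a b)) (le_max_left c (max a b)))]
      exact ⟨min_le_left _ _, le_max_left _ _⟩
    refine h1.mono ?_
    rw [Set.uIcc_of_le (le_trans (min_le_left c (min a b)) (le_max_left c (max a b))), Set.uIcc]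
    exact Set.Icc_subset_Icc (min_le_right _ _) (le_max_right _ _)
  have e : (fun x => ∫ t in c..x, f t) = fun x =>
      ((∫ t in c..x, (f t).re : ℝ) : ℂ) + Complex.I • ((∫ t in c..x, (f t).im : ℝ) : ℂ) := by
    funext x
    rw [← intervalIntegral.integral_ofReal, ← intervalIntegral.integral_ofReal,
      ← intervalIntegral.integral_smul, ← intervalIntegral.integral_add]
    · refine intervalIntegral.integral_congr fun t _ => ?_
      simp only [smul_eq_mul]
      rw [mul_comm, Complex.re_add_im]
    · exact ⟨(hre c x).1.ofReal, (hre c x).2.ofReal⟩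
    · exact ⟨(him c x).1.ofReal.const_mul Complex.I, (him c x).2.ofReal.const_mul Complex.I⟩
  rw [e]
  exact (key _ hre).ofReal_comp.fun_add ((key _ him).ofReal_comp.const_smul _)

theorem absolutelyContinuousOnInterval_of_hasDerivAt {f f' : ℝ → ℂ}
    (h : ∀ x, HasDerivAt f (f' x) x) (hc : Continuous f') (a b : ℝ) :
    AbsolutelyContinuousOnInterval f a b := by
  have e : f = fun x => (f 0) + ∫ t in (0 : ℝ)..x, f' t := by
    funext x
    rw [intervalIntegral.integral_eq_sub_of_hasDerivAt (fun t _ => h t) (hc.intervalIntegrable _ _)]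
    ring
  rw [e]
  exact (LipschitzWith.const (f 0)).lipschitzOnWith.absolutelyContinuousOnInterval.fun_add
    (absolutelyContinuousOnInterval_integral_complex (fun a b => hc.intervalIntegrable a b) 0 a b)

theorem locallyIntegrable_of_intervalIntegrable {f : ℝ → ℂ}
    (hf : ∀ a b, IntervalIntegrable f volume a b) : LocallyIntegrable f volume := by
  intro x
  refine ⟨Set.Ioc (x - 1) (x + 1), Ioc_mem_nhds (by linarith) (by linarith), (hf _ _).1⟩

/-- An absolutely continuous function is the integral of its almost everywhere derivative. -/
theorem AbsolutelyContinuousOnInterval.eq_add_integral {f g : ℝ → ℂ}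
    (hf : ∀ a b, AbsolutelyContinuousOnInterval f a b)
    (hg : ∀ a b, IntervalIntegrable g volume a b)
    (h : ∀ᵐ x, HasDerivAt f (g x) x) (c x : ℝ) : f x = f c + ∫ t in c..x, g t := by
  have h1 : AbsolutelyContinuousOnInterval (fun x => f x - ∫ t in c..x, g t) c x :=
    (hf c x).fun_sub (absolutelyContinuousOnInterval_integral_complex hg c c x)
  obtain ⟨C, hC⟩ := h1.const_of_ae_hasDerivAt_zero (by
    filter_upwards [h, LocallyIntegrable.ae_hasDerivAt_integral (locallyIntegrable_of_intervalIntegrable hg)]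
      with y hy hy' _
    simpa using hy.fun_sub (hy' c))
  have e1 := hC c Set.left_mem_uIcc
  have e2 := hC x Set.right_mem_uIcc
  simp only [intervalIntegral.integral_same, sub_zero] at e1
  rw [e1, ← e2]
  ring

/-- The integral of a continuous function is differentiable everywhere, so the exceptional null set
disappears. This is the passage from almost everywhere equations to classical ones. -/
theorem AbsolutelyContinuousOnInterval.hasDerivAt_of_continuous {f g : ℝ → ℂ}
    (hf : ∀ a b, AbsolutelyContinuousOnInterval f a b) (hg : Continuous g)
    (h : ∀ᵐ x, HasDerivAt f (g x) x) (x : ℝ) : HasDerivAt f (g x) x := by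
  have e : f = fun x => f 0 + ∫ t in (0 : ℝ)..x, g t := funext fun x =>
    eq_add_integral hf (fun a b => hg.intervalIntegrable a b) h 0 x
  rw [e]
  exact (hg.integral_hasStrictDerivAt 0 x).hasDerivAt.const_add _

/-! ### The primitive of the potential -/

/-- The standing assumptions on the potential, with local integrability in place of
integrability over a period. -/
structure HillPotential (q : ℝ → ℂ) : Prop where
  int : ∀ a b, IntervalIntegrable q volume a b
  mean : ∫ x in (0 : ℝ)..Real.pi, q x = 0
  per : ∀ᵐ x : ℝ, q (x + Real.pi) = q x
  pt : ∀ᵐ x : ℝ, (starRingEnd ℂ) (q (-x)) = q x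

theorem intervalIntegrable_of_ae_periodic {q : ℝ → ℂ} {T : ℝ} (hT : 0 < T)
    (hq : IntegrableOn q (Set.Icc 0 T)) (hper : ∀ᵐ x : ℝ, q (x + T) = q x) (a b : ℝ) :
    IntervalIntegrable q volume a b := by
  have hnat : ∀ n : ℕ, ∀ᵐ x : ℝ, q (x + n * T) = q x := by
    intro n
    induction n with
    | zero => simp
    | succ k ih =>
      have h1 := (quasiMeasurePreserving_add_right (volume : Measure ℝ) (k * T)).ae hper
      filter_upwards [ih, h1] with x hx hx1
      rw [← hx, ← hx1]
      congr 1
      push_cast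
      ring
  have hint : ∀ n : ℤ, ∀ᵐ x : ℝ, q (x + n * T) = q x := by
    intro n
    obtain ⟨k, rfl | rfl⟩ := n.eq_nat_or_neg
    · simpa using hnat k
    · have h1 := (quasiMeasurePreserving_add_right (volume : Measure ℝ) (-(k * T))).ae (hnat k)
      filter_upwards [h1] with x hx
      rw [neg_add_cancel_right] at hx
      rw [hx]
      congr 1
      push_cast
      ring
  have hall := ae_all_iff.2 hint
  -- Countably many translates have a null union of exceptional sets, so `q` agrees almost
  -- everywhere with this exactly periodic function.
  set p : ℝ → ℂ := fun x => q (toIcoMod hT 0 x) with hp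
  have hpq : p =ᵐ[volume] q := by
    filter_upwards [hall] with x hx
    rw [hp]
    have := hx (-toIcoDiv hT 0 x)
    rw [← this]
    simp only [toIcoMod, zsmul_eq_mul]
    congr 1
    push_cast
    ring
  have hpp : Function.Periodic p T := fun x => by
    simp only [hp, toIcoMod_add_right]
  have h0 : IntervalIntegrable q volume 0 (0 + T) := by
    rw [zero_add, intervalIntegrable_iff_integrableOn_Icc_of_le hT.le]
    exact hq
  have h1 : IntervalIntegrable p volume 0 (0 + T) :=
    h0.congr_ae (ae_restrict_of_ae hpq.symm)
  exact (hpp.intervalIntegrable hT.ne' h1 a b).congr_ae (ae_restrict_of_ae hpq)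

/-- The primitive of the potential vanishing at the origin. -/
def hillPrimitive (q : ℝ → ℂ) (x : ℝ) : ℂ := ∫ t in (0 : ℝ)..x, q t

namespace HillPotential
variable {q : ℝ → ℂ}

theorem continuous_primitive (hq : HillPotential q) : Continuous (hillPrimitive q) :=
  intervalIntegral.continuous_primitive hq.int 0

theorem absolutelyContinuous_primitive (hq : HillPotential q) (a b : ℝ) :
    AbsolutelyContinuousOnInterval (hillPrimitive q) a b :=
  absolutelyContinuousOnInterval_integral_complex hq.int 0 a b

theorem ae_hasDerivAt_primitive (hq : HillPotential q) : ∀ᵐ x, HasDerivAt (hillPrimitive q) (q x) x := by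
  filter_upwards [LocallyIntegrable.ae_hasDerivAt_integral (locallyIntegrable_of_intervalIntegrable hq.int)]
    with x hx using hx 0

theorem primitive_periodic (hq : HillPotential q) : Function.Periodic (hillPrimitive q) Real.pi := by
  intro x
  have h1 : ∫ t in Real.pi..(x + Real.pi), q t = ∫ t in (0 : ℝ)..x, q t := by
    have := intervalIntegral.integral_comp_add_right (a := 0) (b := x) q Real.pi
    rw [zero_add] at this
    rw [← this]
    refine intervalIntegral.integral_congr_ae ?_
    filter_upwards [hq.per] with t ht _ using ht
  rw [hillPrimitive, ← intervalIntegral.integral_add_adjacent_intervals (hq.int 0 Real.pi)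
    (hq.int _ _), hq.mean, zero_add, h1, hillPrimitive]

theorem primitive_neg (hq : HillPotential q) (x : ℝ) :
    hillPrimitive q (-x) = -(starRingEnd ℂ) (hillPrimitive q x) := by
  have h1 : ∫ t in (0 : ℝ)..x, q (-t) = ∫ t in (-x)..0, q t := by
    simp
  have h2 : ∫ t in (0 : ℝ)..x, q (-t) = (starRingEnd ℂ) (∫ t in (0 : ℝ)..x, q t) := by
    rw [← intervalIntegral.intervalIntegral_conj]
    refine intervalIntegral.integral_congr_ae ?_
    filter_upwards [hq.pt] with t ht _
    rw [← ht, Complex.conj_conj]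
  rw [hillPrimitive, hillPrimitive, intervalIntegral.integral_symm, ← h1, h2]

theorem primitive_pi (hq : HillPotential q) : hillPrimitive q Real.pi = 0 := hq.mean

end HillPotential

theorem hillPrimitive_zero (q : ℝ → ℂ) : hillPrimitive q 0 = 0 := by simp [hillPrimitive]

/-! ### Linear differential equations with bounded continuous coefficients -/

section LinearODE

variable {E : Type*} [NormedAddCommGroup E] [NormedSpace ℂ E]

/-- The weight satisfies `K ∫₀ˣ cosh(2Ks) ds = sinh(2Kx)/2`, which is at most `cosh(2Kx)/2` in
modulus. Relative to it the Volterra operator halves norms, on both half-lines at once. -/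
theorem norm_integral_clm_cosh_le {A : ℝ → E →L[ℂ] E} {K : ℝ}
    (hK : ∀ x, ‖A x‖ ≤ K) {z : ℝ → E} {C : ℝ} (hz : ∀ x, ‖z x‖ ≤ C) (x : ℝ) :
    ‖∫ s in (0 : ℝ)..x, A s (Real.cosh (2 * K * s) • z s)‖ ≤ C / 2 * Real.cosh (2 * K * x) := by
  have hC : 0 ≤ C := (norm_nonneg _).trans (hz 0)
  have hd : ∀ s : ℝ, HasDerivAt (fun s => C / 2 * Real.sinh (2 * K * s))
      (K * C * Real.cosh (2 * K * s)) s := fun s => by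
    have h1 : HasDerivAt (fun s : ℝ => 2 * K * s) (2 * K) s := by
      simpa using (hasDerivAt_id s).const_mul (2 * K)
    have h2 := ((Real.hasDerivAt_sinh (2 * K * s)).comp s h1).const_mul (C / 2)
    exact h2.congr_deriv (by ring)
  have hc : Continuous fun s : ℝ => K * C * Real.cosh (2 * K * s) := by fun_prop
  have h1 : ‖∫ s in (0 : ℝ)..x, A s (Real.cosh (2 * K * s) • z s)‖ ≤
      |∫ s in (0 : ℝ)..x, K * C * Real.cosh (2 * K * s)| := by
    refine intervalIntegral.norm_integral_le_abs_of_norm_le ?_ (hc.intervalIntegrable _ _)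
    refine Filter.Eventually.of_forall fun s => ?_
    have h3 : ‖Real.cosh (2 * K * s) • z s‖ ≤ Real.cosh (2 * K * s) * C := by
      rw [norm_smul, Real.norm_of_nonneg (Real.cosh_pos _).le]
      exact mul_le_mul_of_nonneg_left (hz s) (Real.cosh_pos _).le
    calc ‖A s (Real.cosh (2 * K * s) • z s)‖ ≤ K * (Real.cosh (2 * K * s) * C) :=
          (A s).le_of_opNorm_le_of_le (hK s) h3
      _ = K * C * Real.cosh (2 * K * s) := by ring
  rw [intervalIntegral.integral_eq_sub_of_hasDerivAt (fun s _ => hd s)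
    (hc.intervalIntegrable _ _)] at h1
  simp only [mul_zero, Real.sinh_zero, sub_zero, abs_mul] at h1
  refine h1.trans ?_
  rw [abs_of_nonneg (by positivity : 0 ≤ C / 2)]
  refine mul_le_mul_of_nonneg_left ?_ (by positivity)
  rw [abs_le]
  constructor
  · have := Real.exp_pos (2 * K * x)
    rw [← Real.cosh_add_sinh] at this
    linarith
  · exact (Real.sinh_lt_cosh _).le

/-- Banach's fixed point theorem for `z = Y / cosh(2Kx)` among bounded continuous functions gives a
solution on the whole line in one step. -/
theorem exists_forall_hasDerivAt_clm [CompleteSpace E] {A : ℝ → E →L[ℂ] E} (hA : Continuous A)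
    {K : ℝ} (hK : ∀ x, ‖A x‖ ≤ K) (c : E) :
    ∃ Y : ℝ → E, Y 0 = c ∧ ∀ x, HasDerivAt Y (A x (Y x)) x := by
  have hcont : ∀ z : BoundedContinuousFunction ℝ E,
      Continuous fun s => A s (Real.cosh (2 * K * s) • z s) := fun z =>
    hA.clm_apply ((by fun_prop : Continuous fun s : ℝ => Real.cosh (2 * K * s)).smul z.continuous)
  have hprim : ∀ z : BoundedContinuousFunction ℝ E,
      Continuous fun x => ∫ s in (0 : ℝ)..x, A s (Real.cosh (2 * K * s) • z s) := fun z =>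
    intervalIntegral.continuous_primitive (fun a b => (hcont z).intervalIntegrable a b) 0
  have hch : Continuous fun x : ℝ => (Real.cosh (2 * K * x))⁻¹ :=
    Continuous.inv₀ (by fun_prop) fun x => (Real.cosh_pos _).ne'
  let Φ : BoundedContinuousFunction ℝ E → BoundedContinuousFunction ℝ E := fun z =>
    BoundedContinuousFunction.ofNormedAddCommGroup
      (fun x => (Real.cosh (2 * K * x))⁻¹ •
        (c + ∫ s in (0 : ℝ)..x, A s (Real.cosh (2 * K * s) • z s)))
      (hch.smul (continuous_const.add (hprim z))) (‖c‖ + ‖z‖ / 2) (fun x => by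
        have hp := Real.cosh_pos (2 * K * x)
        rw [norm_smul, norm_inv, Real.norm_of_nonneg hp.le, inv_mul_le_iff₀ hp]
        refine (norm_add_le _ _).trans ?_
        have h1 := norm_integral_clm_cosh_le hK (fun x => z.norm_coe_le_norm x) x
        have h2 := Real.one_le_cosh (2 * K * x)
        nlinarith [norm_nonneg c])
  have hΦ : ∀ z x, Φ z x = (Real.cosh (2 * K * x))⁻¹ •
        (c + ∫ s in (0 : ℝ)..x, A s (Real.cosh (2 * K * s) • z s)) := fun z x => rfl
  have hcontr : ContractingWith (1 / 2) Φ := by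
    refine ⟨by
      rw [← NNReal.coe_lt_coe]; norm_num, LipschitzWith.of_dist_le_mul fun z z' => ?_⟩
    rw [BoundedContinuousFunction.dist_le (by positivity)]
    intro x
    have hp := Real.cosh_pos (2 * K * x)
    have e : (∫ s in (0 : ℝ)..x, A s (Real.cosh (2 * K * s) • z s)) -
        (∫ s in (0 : ℝ)..x, A s (Real.cosh (2 * K * s) • z' s)) =
        ∫ s in (0 : ℝ)..x, A s (Real.cosh (2 * K * s) • (z s - z' s)) := by
      rw [← intervalIntegral.integral_sub ((hcont z).intervalIntegrable _ _)
        ((hcont z').intervalIntegrable _ _)]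
      refine intervalIntegral.integral_congr fun s _ => ?_
      simp only [smul_sub, map_sub]
    have h1 := norm_integral_clm_cosh_le hK (z := fun s => z s - z' s) (C := dist z z')
      (fun s => by rw [← dist_eq_norm]; exact BoundedContinuousFunction.dist_coe_le_dist s) x
    rw [dist_eq_norm, hΦ, hΦ, ← smul_sub, add_sub_add_left_eq_sub, e, norm_smul, norm_inv,
      Real.norm_of_nonneg hp.le, inv_mul_le_iff₀ hp]
    refine h1.trans (le_of_eq ?_)
    push_cast
    ring
  set z := ContractingWith.fixedPoint Φ hcontr with hz
  have hfix : Φ z = z := ContractingWith.fixedPoint_isFixedPt hcontr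
  have hY : ∀ x, Real.cosh (2 * K * x) • z x =
      c + ∫ s in (0 : ℝ)..x, A s (Real.cosh (2 * K * s) • z s) := by
    intro x
    have h1 : z x = Φ z x := by rw [hfix]
    rw [hΦ] at h1
    rw [h1, smul_inv_smul₀ (Real.cosh_pos _).ne']
  refine ⟨fun x => Real.cosh (2 * K * x) • z x, ?_, fun x => ?_⟩
  · exact (hY 0).trans (by rw [intervalIntegral.integral_same, add_zero])
  · have h2 := ((hcont z).integral_hasStrictDerivAt 0 x).hasDerivAt.const_add c
    have h3 : (fun x => Real.cosh (2 * K * x) • z x) =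
        fun x => c + ∫ s in (0 : ℝ)..x, A s (Real.cosh (2 * K * s) • z s) := funext hY
    rw [← h3] at h2
    exact h2

end LinearODE

/-! ### The quasi-derivative system of the Hill equation -/

/-- The coefficient of the first-order system for `(y, y' - Q y)` equivalent to
`-y'' + Q' y = z y`. -/
def hillField (Q : ℝ → ℂ) (z : ℂ) (x : ℝ) : (ℂ × ℂ) →L[ℂ] (ℂ × ℂ) :=
  (ContinuousLinearMap.inl ℂ ℂ ℂ).comp
    (Q x • ContinuousLinearMap.fst ℂ ℂ ℂ + ContinuousLinearMap.snd ℂ ℂ ℂ) +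
  (ContinuousLinearMap.inr ℂ ℂ ℂ).comp
    (-(z + Q x ^ 2) • ContinuousLinearMap.fst ℂ ℂ ℂ - Q x • ContinuousLinearMap.snd ℂ ℂ ℂ)

theorem hillField_apply (Q : ℝ → ℂ) (z : ℂ) (x : ℝ) (p : ℂ × ℂ) :
    hillField Q z x p = (Q x * p.1 + p.2, -(z + Q x ^ 2) * p.1 - Q x * p.2) := by
  simp [hillField]

/-- `Y` solves the quasi-derivative system of `-y'' + q y = z y`. -/
def IsHillSolution (q : ℝ → ℂ) (z : ℂ) (Y : ℝ → ℂ × ℂ) : Prop :=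
  ∀ x, HasDerivAt Y (hillField (hillPrimitive q) z x (Y x)) x

theorem isHillSolution_iff {q : ℝ → ℂ} {z : ℂ} {Y : ℝ → ℂ × ℂ} :
    IsHillSolution q z Y ↔ ∀ x,
      HasDerivAt (fun x => (Y x).1) (hillPrimitive q x * (Y x).1 + (Y x).2) x ∧
      HasDerivAt (fun x => (Y x).2)
        (-(z + hillPrimitive q x ^ 2) * (Y x).1 - hillPrimitive q x * (Y x).2) x := by
  refine forall_congr' fun x => ?_
  rw [hillField_apply]
  constructor
  · intro h
    have h1 := (hasFDerivAt_fst (𝕜 := ℝ) (p := Y x)).comp_hasDerivAt x h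
    have h2 := (hasFDerivAt_snd (𝕜 := ℝ) (p := Y x)).comp_hasDerivAt x h
    exact ⟨h1, h2⟩
  · rintro ⟨h1, h2⟩
    exact h1.prodMk h2

namespace IsHillSolution

variable {q : ℝ → ℂ} {z : ℂ} {Y Y' : ℝ → ℂ × ℂ}

theorem continuous (h : IsHillSolution q z Y) : Continuous Y :=
  continuous_iff_continuousAt.2 fun x => (h x).continuousAt

theorem add (h : IsHillSolution q z Y) (h' : IsHillSolution q z Y') :
    IsHillSolution q z (fun x => Y x + Y' x) := fun x => by
  rw [map_add]
  exact (h x).fun_add (h' x)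

theorem smul (h : IsHillSolution q z Y) (c : ℂ) : IsHillSolution q z (fun x => c • Y x) :=
  fun x => by
  rw [map_smul]
  exact (h x).fun_const_smul c

/-- The coefficient matrix of the system has trace zero. -/
theorem hasDerivAt_wronskian (h : IsHillSolution q z Y) (h' : IsHillSolution q z Y') (x : ℝ) :
    HasDerivAt (fun x => (Y x).1 * (Y' x).2 - (Y x).2 * (Y' x).1) 0 x := by
  have h1 := isHillSolution_iff.1 h x
  have h2 := isHillSolution_iff.1 h' x
  exact ((h1.1.fun_mul h2.2).fun_sub (h1.2.fun_mul h2.1)).congr_deriv (by ring)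

theorem wronskian_eq (h : IsHillSolution q z Y) (h' : IsHillSolution q z Y') (x : ℝ) :
    (Y x).1 * (Y' x).2 - (Y x).2 * (Y' x).1 = (Y 0).1 * (Y' 0).2 - (Y 0).2 * (Y' 0).1 :=
  is_const_of_deriv_eq_zero
    (f := fun x => (Y x).1 * (Y' x).2 - (Y x).2 * (Y' x).1)
    (fun x => (h.hasDerivAt_wronskian h' x).differentiableAt)
    (fun x => (h.hasDerivAt_wronskian h' x).deriv) x 0

end IsHillSolution

namespace HillPotential

variable {q : ℝ → ℂ}

theorem continuous_hillField (hq : HillPotential q) (z : ℂ) :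
    Continuous (hillField (hillPrimitive q) z) := by
  have := hq.continuous_primitive
  unfold hillField
  fun_prop

/-- The primitive is continuous and periodic, hence bounded. Uniformity in `x` gives global
solutions; the explicit dependence on `z` gives a locally uniform Lipschitz constant for continuity
in `z`. -/
theorem exists_norm_hillField_le (hq : HillPotential q) :
    ∃ K : ℝ, 0 < K ∧ ∀ z x, ‖hillField (hillPrimitive q) z x‖ ≤ K + ‖z‖ := by
  have hper : Function.Periodic (hillPrimitive q) Real.pi := hq.primitive_periodic
  obtain ⟨C, hC⟩ := (hper.isBounded_of_continuous Real.pi_ne_zero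
    hq.continuous_primitive).exists_norm_le
  have hC' : ∀ x, ‖hillPrimitive q x‖ ≤ C := fun x => hC _ (Set.mem_range_self x)
  have hC0 : 0 ≤ C := (norm_nonneg _).trans (hC' 0)
  refine ⟨2 * C + C ^ 2 + 1, by positivity, fun z x => ?_⟩
  refine ContinuousLinearMap.opNorm_le_bound _ (by positivity) fun p => ?_
  rw [hillField_apply]
  have h1 := norm_fst_le p
  have h2 := norm_snd_le p
  have h3 := hC' x
  have hp := norm_nonneg p
  refine norm_prod_le_iff.2 ⟨?_, ?_⟩
  · calc ‖hillPrimitive q x * p.1 + p.2‖ ≤ ‖hillPrimitive q x‖ * ‖p.1‖ + ‖p.2‖ := by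
          rw [← norm_mul]; exact norm_add_le _ _
      _ ≤ C * ‖p‖ + ‖p‖ := by gcongr
      _ ≤ _ := by nlinarith [mul_nonneg hC0 hp, mul_nonneg (sq_nonneg C) hp,
                    mul_nonneg (norm_nonneg z) hp]
  · calc ‖-(z + hillPrimitive q x ^ 2) * p.1 - hillPrimitive q x * p.2‖
        ≤ (‖z‖ + ‖hillPrimitive q x‖ ^ 2) * ‖p.1‖ + ‖hillPrimitive q x‖ * ‖p.2‖ := by
          refine (norm_sub_le _ _).trans ?_
          rw [norm_mul, norm_mul, norm_neg, ← norm_pow]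
          gcongr
          exact norm_add_le _ _
      _ ≤ (‖z‖ + C ^ 2) * ‖p‖ + C * ‖p‖ := by gcongr
      _ ≤ _ := by nlinarith [mul_nonneg hC0 hp]

theorem exists_solution (hq : HillPotential q) (z : ℂ) (c : ℂ × ℂ) :
    ∃ Y, Y 0 = c ∧ IsHillSolution q z Y := by
  obtain ⟨K, -, hK⟩ := hq.exists_norm_hillField_le
  exact exists_forall_hasDerivAt_clm (hq.continuous_hillField z) (hK z) c

theorem solution_unique (hq : HillPotential q) {z : ℂ} {Y Y' : ℝ → ℂ × ℂ}
    (h : IsHillSolution q z Y) (h' : IsHillSolution q z Y') {x : ℝ} (hx : Y x = Y' x) :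
    Y = Y' := by
  obtain ⟨K, hK0, hK⟩ := hq.exists_norm_hillField_le
  refine ODE_solution_unique_univ (v := fun x p => hillField (hillPrimitive q) z x p)
    (s := fun _ => Set.univ) (K := ⟨K + ‖z‖, by positivity⟩) (t₀ := x) (fun t => ?_)
    (fun t => ⟨h t, trivial⟩) (fun t => ⟨h' t, trivial⟩) hx
  exact (ContinuousLinearMap.lipschitzWith_of_opNorm_le (hK z t)).lipschitzOnWith

theorem solution_add_pi (hq : HillPotential q) {z : ℂ} {Y : ℝ → ℂ × ℂ}
    (h : IsHillSolution q z Y) : IsHillSolution q z (fun x => Y (x + Real.pi)) := fun x => by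
  have h1 := (h (x + Real.pi)).comp_add_const x Real.pi
  have h2 : hillField (hillPrimitive q) z (x + Real.pi) = hillField (hillPrimitive q) z x := by
    simp only [hillField, hq.primitive_periodic x]
  rwa [h2] at h1

end HillPotential

open Classical in
/-- The solution of the quasi-derivative system with the initial value `c` at the origin. -/
def hillSolution (q : ℝ → ℂ) (z : ℂ) (c : ℂ × ℂ) : ℝ → ℂ × ℂ :=
  if h : ∃ Y, Y 0 = c ∧ IsHillSolution q z Y then h.choose else 0

/-- The Hill discriminant, the trace of the monodromy matrix. -/
def hillDiscriminant (q : ℝ → ℂ) (z : ℂ) : ℂ :=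
  (hillSolution q z (1, 0) Real.pi).1 + (hillSolution q z (0, 1) Real.pi).2

namespace HillPotential

variable {q : ℝ → ℂ}

theorem hillSolution_zero (hq : HillPotential q) (z : ℂ) (c : ℂ × ℂ) :
    hillSolution q z c 0 = c := by
  rw [hillSolution, dif_pos (hq.exists_solution z c)]
  exact (hq.exists_solution z c).choose_spec.1

theorem isHillSolution_hillSolution (hq : HillPotential q) (z : ℂ) (c : ℂ × ℂ) :
    IsHillSolution q z (hillSolution q z c) := by
  rw [hillSolution, dif_pos (hq.exists_solution z c)]
  exact (hq.exists_solution z c).choose_spec.2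

theorem solution_eq (hq : HillPotential q) {z : ℂ} {Y : ℝ → ℂ × ℂ} (h : IsHillSolution q z Y)
    (x : ℝ) : Y x = (Y 0).1 • hillSolution q z (1, 0) x + (Y 0).2 • hillSolution q z (0, 1) x := by
  have h1 := ((hq.isHillSolution_hillSolution z (1, 0)).smul (Y 0).1).add
    ((hq.isHillSolution_hillSolution z (0, 1)).smul (Y 0).2)
  refine congrFun (hq.solution_unique h h1 (x := 0) ?_) x
  simp [hq.hillSolution_zero]

theorem monodromy_det (hq : HillPotential q) (z : ℂ) :
    (hillSolution q z (1, 0) Real.pi).1 * (hillSolution q z (0, 1) Real.pi).2 -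
      (hillSolution q z (1, 0) Real.pi).2 * (hillSolution q z (0, 1) Real.pi).1 = 1 := by
  rw [(hq.isHillSolution_hillSolution z (1, 0)).wronskian_eq
    (hq.isHillSolution_hillSolution z (0, 1)) Real.pi]
  simp [hq.hillSolution_zero]

/-- Every root of the characteristic equation is the multiplier of a Floquet solution. -/
theorem exists_floquet (hq : HillPotential q) {z ρ : ℂ}
    (hρ : ρ ^ 2 - hillDiscriminant q z * ρ + 1 = 0) :
    ∃ Y, IsHillSolution q z Y ∧ Y 0 ≠ 0 ∧ ∀ x, Y (x + Real.pi) = ρ • Y x := by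
  have hdet := hq.monodromy_det z
  rw [hillDiscriminant] at hρ
  set a := (hillSolution q z (1, 0) Real.pi).1 with ha
  set c := (hillSolution q z (1, 0) Real.pi).2 with hc
  set b := (hillSolution q z (0, 1) Real.pi).1 with hb
  set d := (hillSolution q z (0, 1) Real.pi).2 with hd
  -- An eigenvector of the monodromy matrix, read off from a row with a nonzero off-diagonal entry;
  -- a diagonal matrix has the coordinate vectors.
  obtain ⟨v, hv, h1, h2⟩ : ∃ v : ℂ × ℂ, v ≠ 0 ∧ v.1 * a + v.2 * b = ρ * v.1 ∧
      v.1 * c + v.2 * d = ρ * v.2 := by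
    have hchar : (ρ - a) * (ρ - d) = b * c := by linear_combination hρ + hdet
    by_cases hb0 : b = 0
    · by_cases hc0 : c = 0
      · rw [hb0, zero_mul, mul_eq_zero] at hchar
        rcases hchar with h | h
        · exact ⟨(1, 0), by simp, by simp; linear_combination -h, by simp [hc0]⟩
        · exact ⟨(0, 1), by simp, by simp [hb0], by simp; linear_combination -h⟩
      · exact ⟨(ρ - d, c), by simp [hc0], by simp; linear_combination -hchar, by simp; ring⟩
    · exact ⟨(b, ρ - a), by simp [hb0], by simp; ring, by simp; linear_combination -hchar⟩
  have hY := hq.isHillSolution_hillSolution z v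
  refine ⟨hillSolution q z v, hY, by rwa [hq.hillSolution_zero], fun x => ?_⟩
  refine congrFun (hq.solution_unique (hq.solution_add_pi hY) (hY.smul ρ) (x := 0) ?_) x
  rw [zero_add, hq.solution_eq hY Real.pi, hq.hillSolution_zero]
  refine Prod.ext ?_ ?_
  · simpa using h1
  · simpa using h2

/-- The reflection `y ↦ conj y(-x)` maps solutions for real parameters to solutions. -/
theorem solution_reflect (hq : HillPotential q) {r : ℝ} {Y : ℝ → ℂ × ℂ}
    (h : IsHillSolution q r Y) : IsHillSolution q r
      (fun x => ((starRingEnd ℂ) (Y (-x)).1, -(starRingEnd ℂ) (Y (-x)).2)) := by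
  rw [isHillSolution_iff] at h ⊢
  intro x
  have e : hillPrimitive q x = -(starRingEnd ℂ) (hillPrimitive q (-x)) := by
    rw [hq.primitive_neg, map_neg, Complex.conj_conj, neg_neg]
  have key : ∀ {g : ℝ → ℂ} {g' : ℂ}, HasDerivAt g g' (-x) →
      HasDerivAt (fun x => (starRingEnd ℂ) (g (-x))) (-(starRingEnd ℂ) g') x := by
    intro g g' hg
    have h1 := hg.scomp x (hasDerivAt_neg x)
    have h2 := Complex.conjCLE.toContinuousLinearMap.hasFDerivAt.comp_hasDerivAt x h1
    simpa [Function.comp_def] using h2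
  constructor
  · refine (key (h (-x)).1).congr_deriv ?_
    simp only [e, map_add, map_mul]
    ring
  · refine (key (h (-x)).2).fun_neg.congr_deriv ?_
    simp only [e, map_sub, map_neg, map_add, map_mul, map_pow, Complex.conj_ofReal]
    ring

/-- The matrix at `-π` inverts the one at `π`, which has determinant 1, so its upper left entry is
`d`. By reflection that entry is also the conjugate of `a`. Hence the trace is `d` plus its
conjugate. -/
theorem hillDiscriminant_im (hq : HillPotential q) (r : ℝ) : (hillDiscriminant q r).im = 0 := by
  have hθ := hq.isHillSolution_hillSolution r (1, 0)
  have hφ := hq.isHillSolution_hillSolution r (0, 1)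
  have hdet := hq.monodromy_det r
  have e1 := hq.solution_eq (hq.solution_reflect hθ) Real.pi
  have e2 := hq.solution_eq (hq.solution_reflect hφ) Real.pi
  have s1 := hq.solution_eq (hq.solution_add_pi hθ) (-Real.pi)
  have s2 := hq.solution_eq (hq.solution_add_pi hφ) (-Real.pi)
  simp only [neg_add_cancel, zero_add, hq.hillSolution_zero, neg_zero, Prod.ext_iff] at e1 e2 s1 s2
  rw [hillDiscriminant]
  set a := (hillSolution q r (1, 0) Real.pi).1 with ha
  set c := (hillSolution q r (1, 0) Real.pi).2 with hc
  set b := (hillSolution q r (0, 1) Real.pi).1 with hb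
  set d := (hillSolution q r (0, 1) Real.pi).2 with hd
  simp only [map_one, map_zero, neg_zero, Prod.fst_add, Prod.snd_add, Prod.smul_fst,
    Prod.smul_snd, smul_eq_mul, one_mul, zero_mul, add_zero, zero_add, neg_mul] at e1 e2 s1 s2
  have hθ1 : (hillSolution q r (1, 0) (-Real.pi)).1 = d := by
    linear_combination (-(hillSolution q r (1, 0) (-Real.pi)).1) * hdet - d * s1.1 + c * s2.1
  have h3 : (starRingEnd ℂ) d = a := by
    rw [← hθ1]; exact e1.1
  rw [← h3, Complex.add_im, Complex.conj_im]
  ring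

/-- Grönwall: the solution for `z₀` solves the system for `z` up to an error of at most `|z - z₀|`
times its maximum on `[0, π]`. -/
theorem continuous_hillSolution_pi (hq : HillPotential q) (c : ℂ × ℂ) :
    Continuous fun z => hillSolution q z c Real.pi := by
  obtain ⟨K, hK0, hK⟩ := hq.exists_norm_hillField_le
  rw [continuous_iff_continuousAt]
  intro z₀
  have hY₀ := hq.isHillSolution_hillSolution z₀ c
  obtain ⟨B, hB⟩ := (isCompact_Icc (a := (0 : ℝ)) (b := Real.pi)).exists_bound_of_continuousOn
    hY₀.continuous.continuousOn
  have hbound : ∀ z ∈ Metric.ball z₀ 1,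
      dist (hillSolution q z c Real.pi) (hillSolution q z₀ c Real.pi) ≤
        gronwallBound 0 (K + ‖z₀‖ + 1) (dist z z₀ * B) Real.pi := by
    intro z hz
    have hY := hq.isHillSolution_hillSolution z c
    have hzn : ‖z‖ ≤ ‖z₀‖ + 1 := by
      have h1 : ‖z - z₀‖ < 1 := by simpa [dist_eq_norm] using hz
      have h2 := norm_add_le (z - z₀) z₀
      rw [sub_add_cancel] at h2
      linarith
    have h := dist_le_of_approx_trajectories_ODE (a := 0) (b := Real.pi) (δ := 0)
      (εf := 0) (εg := dist z z₀ * B) (K := ⟨K + ‖z₀‖ + 1, by positivity⟩)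
      (v := fun x p => hillField (hillPrimitive q) z x p)
      (f := hillSolution q z c) (g := hillSolution q z₀ c)
      (fun t => ContinuousLinearMap.lipschitzWith_of_opNorm_le
        ((hK z t).trans (by change _ ≤ K + ‖z₀‖ + 1; linarith)))
      hY.continuous.continuousOn (fun t _ => (hY t).hasDerivWithinAt) (fun t _ => by simp)
      hY₀.continuous.continuousOn (fun t _ => (hY₀ t).hasDerivWithinAt) (fun t ht => ?_)
      (by simp [hq.hillSolution_zero]) Real.pi (Set.right_mem_Icc.2 Real.pi_pos.le)
    · rwa [zero_add, sub_zero] at h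
    · have h1 := (norm_fst_le _).trans (hB t ⟨ht.1, ht.2.le⟩)
      rw [hillField_apply, hillField_apply, dist_eq_norm, dist_eq_norm]
      rw [Prod.mk_sub_mk, sub_self, Prod.norm_mk, norm_zero, max_eq_right (norm_nonneg _)]
      calc _ = ‖(z - z₀) * (hillSolution q z₀ c t).1‖ := by congr 1; ring
        _ ≤ _ := by rw [norm_mul]; gcongr
  rw [ContinuousAt, tendsto_iff_dist_tendsto_zero]
  have hlim : Filter.Tendsto (fun z => gronwallBound 0 (K + ‖z₀‖ + 1) (dist z z₀ * B) Real.pi)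
      (nhds z₀) (nhds 0) := by
    have h1 : Continuous fun z => gronwallBound 0 (K + ‖z₀‖ + 1) (dist z z₀ * B) Real.pi :=
      (gronwallBound_continuous_ε 0 (K + ‖z₀‖ + 1) Real.pi).comp (by fun_prop)
    have h2 := h1.tendsto z₀
    simpa [gronwallBound_ε0_δ0] using h2
  refine squeeze_zero' (Filter.Eventually.of_forall fun _ => dist_nonneg) ?_ hlim
  filter_upwards [Metric.ball_mem_nhds z₀ one_pos] with z hz using hbound z hz

theorem continuous_hillDiscriminant (hq : HillPotential q) : Continuous (hillDiscriminant q) :=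
  (hq.continuous_hillSolution_pi _).fst.add (hq.continuous_hillSolution_pi _).snd

end HillPotential

/-! ### The Hill equation and its quasi-derivative system -/

/-- The derivative of the first component of a solution of the quasi-derivative system. -/
def hillDeriv (q : ℝ → ℂ) (Y : ℝ → ℂ × ℂ) (x : ℝ) : ℂ := hillPrimitive q x * (Y x).1 + (Y x).2

namespace IsHillSolution

variable {q : ℝ → ℂ} {z : ℂ} {Y : ℝ → ℂ × ℂ}

theorem hasDerivAt_fst (h : IsHillSolution q z Y) (x : ℝ) :
    HasDerivAt (fun x => (Y x).1) (hillDeriv q Y x) x := (isHillSolution_iff.1 h x).1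

theorem continuous_hillDeriv (hq : HillPotential q) (h : IsHillSolution q z Y) :
    Continuous (hillDeriv q Y) :=
  (hq.continuous_primitive.mul h.continuous.fst).add h.continuous.snd

theorem absolutelyContinuous_fst (hq : HillPotential q) (h : IsHillSolution q z Y) (a b : ℝ) :
    AbsolutelyContinuousOnInterval (fun x => (Y x).1) a b :=
  absolutelyContinuousOnInterval_of_hasDerivAt h.hasDerivAt_fst (h.continuous_hillDeriv hq) a b

theorem absolutelyContinuous_hillDeriv (hq : HillPotential q) (h : IsHillSolution q z Y)
    (a b : ℝ) : AbsolutelyContinuousOnInterval (hillDeriv q Y) a b := by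
  have hQ := hq.continuous_primitive
  have h1 := h.continuous.fst
  have h2 := h.continuous.snd
  exact ((hq.absolutelyContinuous_primitive a b).fun_smul
    (h.absolutelyContinuous_fst hq a b)).fun_add
    (absolutelyContinuousOnInterval_of_hasDerivAt (fun x => (isHillSolution_iff.1 h x).2)
      (by fun_prop) a b)

theorem ae_hasDerivAt_hillDeriv (hq : HillPotential q) (h : IsHillSolution q z Y) :
    ∀ᵐ x, HasDerivAt (hillDeriv q Y) (q x * (Y x).1 - z * (Y x).1) x := by
  filter_upwards [hq.ae_hasDerivAt_primitive] with x hx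
  have h1 := isHillSolution_iff.1 h x
  exact ((hx.fun_mul h1.1).fun_add h1.2).congr_deriv (by ring)

theorem hillDeriv_zero (q : ℝ → ℂ) (Y : ℝ → ℂ × ℂ) : hillDeriv q Y 0 = (Y 0).2 := by
  simp [hillDeriv, hillPrimitive_zero]

theorem hillDeriv_pi (hq : HillPotential q) (Y : ℝ → ℂ × ℂ) :
    hillDeriv q Y Real.pi = (Y Real.pi).2 := by
  simp [hillDeriv, hq.primitive_pi]

/-- If `y` vanished on an interval, so would `y'`, and uniqueness would make the solution trivial.
-/
theorem exists_fst_ne_zero (hq : HillPotential q) (h : IsHillSolution q z Y) (h0 : Y 0 ≠ 0)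
    {a b : ℝ} (hab : a < b) : ∃ x ∈ Set.Ioo a b, (Y x).1 ≠ 0 := by
  by_contra! hcon
  set m := (a + b) / 2 with hm
  have hmem : m ∈ Set.Ioo a b := ⟨by rw [hm]; linarith, by rw [hm]; linarith⟩
  have h1 : (fun x => (Y x).1) =ᶠ[nhds m] fun _ => 0 := by
    filter_upwards [isOpen_Ioo.mem_nhds hmem] with x hx using hcon x hx
  have h2 : hillDeriv q Y m = 0 :=
    (h.hasDerivAt_fst m).unique ((hasDerivAt_const m (0 : ℂ)).congr_of_eventuallyEq h1)
  have h3 : (Y m).1 = 0 := hcon m hmem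
  have h4 : (Y m).2 = 0 := by simpa [hillDeriv, h3] using h2
  have hz : IsHillSolution q z fun _ => (0 : ℂ × ℂ) := fun x => by
    rw [map_zero]; exact hasDerivAt_const x _
  have h5 := hq.solution_unique h hz (x := m) (Prod.ext h3 h4)
  exact h0 (congrFun h5 0)

end IsHillSolution

/-- In the derivative of `v - Q u` the term `q u` cancels, so what remains is continuous and the
equation holds everywhere. -/
theorem HillPotential.isHillSolution_of_hasDerivAt {q : ℝ → ℂ} (hq : HillPotential q) {z : ℂ}
    {u v : ℝ → ℂ} (hu : ∀ x, HasDerivAt u (v x) x)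
    (hv : ∀ a b, AbsolutelyContinuousOnInterval v a b)
    (h : ∀ᵐ x, HasDerivAt v (q x * u x - z * u x) x) :
    IsHillSolution q z fun x => (u x, v x - hillPrimitive q x * u x) := by
  have hvc : Continuous v := continuous_iff_continuousAt.2 fun x =>
    ((hv (x - 1) (x + 1)).continuousOn).continuousAt (by
      rw [Set.uIcc_of_le (by linarith)]
      exact Icc_mem_nhds (by linarith) (by linarith))
  have huc : Continuous u := continuous_iff_continuousAt.2 fun x => (hu x).continuousAt
  have hQ := hq.continuous_primitive
  rw [isHillSolution_iff]
  refine fun x => ⟨(hu x).congr_deriv (by ring), ?_⟩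
  refine AbsolutelyContinuousOnInterval.hasDerivAt_of_continuous
    (g := fun x => -(z + hillPrimitive q x ^ 2) * u x -
      hillPrimitive q x * (v x - hillPrimitive q x * u x)) (fun a b => ?_) (by fun_prop) ?_ x
  · exact (hv a b).fun_sub ((hq.absolutelyContinuous_primitive a b).fun_smul
      (absolutelyContinuousOnInterval_of_hasDerivAt hu hvc a b))
  · filter_upwards [h, hq.ae_hasDerivAt_primitive] with y hy hy'
    exact (hy.fun_sub (hy'.fun_mul (hu y))).congr_deriv (by ring)

/-! ### Bloch eigenvalues -/

/-- As `Q` vanishes at `0` and `π`, quasi-derivative and derivative agree at both ends, so a Floquet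
solution with multiplier `e^{it}` meets the boundary conditions. -/
theorem HillPotential.isBlochEigenvalue {q : ℝ → ℂ} (hq : HillPotential q) {t : ℝ} {z : ℂ}
    (h : Complex.exp (Complex.I * t) ^ 2 - hillDiscriminant q z * Complex.exp (Complex.I * t) + 1
      = 0) : IsBlochEigenvalue q t z := by
  obtain ⟨Y, hY, h0, hper⟩ := hq.exists_floquet h
  have hpi := hper 0
  rw [zero_add, Prod.ext_iff] at hpi
  refine ⟨fun x => (Y x).1, hillDeriv q Y, ?_, fun x _ => (hY.hasDerivAt_fst x).hasDerivWithinAt,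
    hY.absolutelyContinuous_hillDeriv hq _ _, ae_restrict_of_ae (hY.ae_hasDerivAt_hillDeriv hq),
    hpi.1, ?_⟩
  · obtain ⟨x, hx, hx'⟩ := hY.exists_fst_ne_zero hq h0 Real.pi_pos
    exact ⟨x, Set.Ioo_subset_Icc_self hx, hx'⟩
  · rw [IsHillSolution.hillDeriv_pi hq, IsHillSolution.hillDeriv_zero]
    exact hpi.2

/-! ### Asymptotics of the discriminant -/

namespace IsHillSolution

variable {q : ℝ → ℂ} {Y : ℝ → ℂ × ℂ}

/-- Factoring `y'' + κ² y = q y` shows that `e^{-iκx} (y' + iκy)` has derivative `e^{-iκx} q y`. The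
sign of `κ` is free, and both signs are used below. -/
theorem norm_exp_mul_sub_le (hq : HillPotential q) {κ : ℝ}
    (h : IsHillSolution q ((κ : ℂ) ^ 2) Y) {M : ℝ} (hM : ∀ x ∈ Set.Icc 0 Real.pi, ‖(Y x).1‖ ≤ M)
    {x : ℝ} (hx : x ∈ Set.Icc 0 Real.pi) :
    ‖Complex.exp (-(Complex.I * κ * x)) * (hillDeriv q Y x + Complex.I * κ * (Y x).1) -
      ((Y 0).2 + Complex.I * κ * (Y 0).1)‖ ≤ (∫ t in (0 : ℝ)..Real.pi, ‖q t‖) * M := by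
  have hexp : ∀ x : ℝ, HasDerivAt (fun x : ℝ => Complex.exp (-(Complex.I * κ * x)))
      (-(Complex.I * κ) * Complex.exp (-(Complex.I * κ * x))) x := fun x => by
    have h1 : HasDerivAt (fun x : ℝ => -(Complex.I * κ * x)) (-(Complex.I * κ)) x := by
      simpa using ((hasDerivAt_id x).ofReal_comp.const_mul (Complex.I * κ)).fun_neg
    exact h1.cexp.congr_deriv (by ring)
  have hcexp : Continuous fun x : ℝ => Complex.exp (-(Complex.I * κ * x)) := by fun_prop
  have hne : ∀ x : ℝ, ‖Complex.exp (-(Complex.I * κ * x))‖ = 1 := fun x => by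
    rw [show -(Complex.I * κ * x) = ((-(κ * x) : ℝ) : ℂ) * Complex.I by push_cast; ring]
    exact Complex.norm_exp_ofReal_mul_I _
  set g : ℝ → ℂ := fun x => q x * (Complex.exp (-(Complex.I * κ * x)) * (Y x).1) with hg
  have hgint : ∀ a b, IntervalIntegrable g volume a b := fun a b =>
    (hq.int a b).mul_continuousOn (hcexp.mul h.continuous.fst).continuousOn
  have key := AbsolutelyContinuousOnInterval.eq_add_integral
    (f := fun x => Complex.exp (-(Complex.I * κ * x)) *
      (hillDeriv q Y x + Complex.I * κ * (Y x).1)) (g := g) (fun a b => ?_) hgint ?_ 0 x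
  · simp only [hillDeriv_zero, Complex.ofReal_zero, mul_zero, neg_zero, Complex.exp_zero,
      one_mul] at key
    rw [key, add_sub_cancel_left]
    have h1 : ‖∫ t in (0 : ℝ)..x, g t‖ ≤ ∫ t in (0 : ℝ)..x, ‖q t‖ * M := by
      refine intervalIntegral.norm_integral_le_of_norm_le hx.1
        (Filter.Eventually.of_forall fun t ht => ?_) ((hq.int 0 x).norm.mul_const M)
      rw [hg, norm_mul, norm_mul, hne, one_mul]
      exact mul_le_mul_of_nonneg_left (hM t ⟨ht.1.le, ht.2.trans hx.2⟩) (norm_nonneg _)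
    refine h1.trans ?_
    rw [intervalIntegral.integral_mul_const]
    have hM0 : 0 ≤ M := (norm_nonneg _).trans (hM x hx)
    refine mul_le_mul_of_nonneg_right ?_ hM0
    exact intervalIntegral.integral_mono_interval le_rfl hx.1 hx.2
      (Filter.Eventually.of_forall fun t => norm_nonneg _) (hq.int 0 Real.pi).norm
  · exact (absolutelyContinuousOnInterval_of_hasDerivAt hexp (by fun_prop) a b).fun_smul
      ((h.absolutelyContinuous_hillDeriv hq a b).fun_add
        ((h.absolutelyContinuous_fst hq a b).const_smul (Complex.I * κ)))
  · filter_upwards [h.ae_hasDerivAt_hillDeriv hq] with t ht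
    refine ((hexp t).fun_mul (ht.fun_add ((h.hasDerivAt_fst t).const_mul
      (Complex.I * κ)))).congr_deriv ?_
    rw [hg]
    linear_combination (-(κ : ℂ) ^ 2 * (Y t).1 * Complex.exp (-(Complex.I * κ * t))) *
      Complex.I_sq

/-- At a maximum point of `|y|`, subtracting the estimates for `κ = k` and `κ = -k` isolates `2ik
y`. The resulting term `N M` is absorbed because `N ≤ k/2`. -/
theorem norm_fst_le_of_large (hq : HillPotential q) {k : ℝ} (hk : 0 < k)
    (hkN : 2 * (∫ t in (0 : ℝ)..Real.pi, ‖q t‖) ≤ k) (h : IsHillSolution q ((k : ℂ) ^ 2) Y)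
    {x : ℝ} (hx : x ∈ Set.Icc 0 Real.pi) :
    ‖(Y x).1‖ ≤ 2 * (‖(Y 0).2‖ + k * ‖(Y 0).1‖) / k := by
  set N := ∫ t in (0 : ℝ)..Real.pi, ‖q t‖ with hN
  obtain ⟨m, hm, hmax⟩ := isCompact_Icc.exists_isMaxOn (Set.nonempty_Icc.2 Real.pi_pos.le)
    (h.continuous.fst.norm.continuousOn (s := Set.Icc 0 Real.pi))
  set M := ‖(Y m).1‖ with hMdef
  have hM : ∀ x ∈ Set.Icc 0 Real.pi, ‖(Y x).1‖ ≤ M := fun x hx => hmax hx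
  have hb : ∀ κ : ℝ, |κ| = k → ‖hillDeriv q Y m + Complex.I * κ * (Y m).1‖ ≤
      ‖(Y 0).2‖ + k * ‖(Y 0).1‖ + N * M := by
    intro κ hκ
    have hκ2 : ((κ : ℂ)) ^ 2 = (k : ℂ) ^ 2 := by
      rw [← hκ]; norm_cast; rw [sq_abs]
    have h1 := norm_exp_mul_sub_le hq (κ := κ) (by rwa [hκ2]) hM hm
    have hne : ‖Complex.exp (-(Complex.I * κ * m))‖ = 1 := by
      rw [show -(Complex.I * κ * m) = ((-(κ * m) : ℝ) : ℂ) * Complex.I by push_cast; ring]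
      exact Complex.norm_exp_ofReal_mul_I _
    have h2 := norm_le_norm_add_norm_sub' (Complex.exp (-(Complex.I * κ * m)) *
      (hillDeriv q Y m + Complex.I * κ * (Y m).1)) ((Y 0).2 + Complex.I * κ * (Y 0).1)
    rw [norm_mul, hne, one_mul] at h2
    have h3 : ‖(Y 0).2 + Complex.I * κ * (Y 0).1‖ ≤ ‖(Y 0).2‖ + k * ‖(Y 0).1‖ := by
      refine (norm_add_le _ _).trans ?_
      rw [norm_mul, norm_mul, Complex.norm_I, one_mul, Complex.norm_real, Real.norm_eq_abs, hκ]
    linarith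
  have h1 := hb k (abs_of_pos hk)
  have h2 := hb (-k) (by rw [abs_neg, abs_of_pos hk])
  have h3 : 2 * k * M ≤ 2 * (‖(Y 0).2‖ + k * ‖(Y 0).1‖ + N * M) := by
    have e : ‖(2 * k * Complex.I) * (Y m).1‖ = 2 * k * M := by
      rw [norm_mul, norm_mul, norm_mul, Complex.norm_I, Complex.norm_real, Real.norm_of_nonneg hk.le]
      simp [hMdef]
    rw [← e, show (2 * k * Complex.I) * (Y m).1 = (hillDeriv q Y m + Complex.I * k * (Y m).1) -
      (hillDeriv q Y m + Complex.I * ((-k : ℝ) : ℂ) * (Y m).1) by push_cast; ring]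
    exact (norm_sub_le _ _).trans (by linarith)
  refine (hM x hx).trans ?_
  rw [le_div_iff₀ hk]
  have hM0 : 0 ≤ M := norm_nonneg _
  nlinarith

end IsHillSolution

theorem HillPotential.norm_hillDiscriminant_sub_le {q : ℝ → ℂ} (hq : HillPotential q) {k : ℝ}
    (hk : 0 < k) (hkN : 2 * (∫ t in (0 : ℝ)..Real.pi, ‖q t‖) ≤ k) :
    ‖hillDiscriminant q ((k ^ 2 : ℝ) : ℂ) - (2 * Real.cos (k * Real.pi) : ℝ)‖ ≤
      4 * (∫ t in (0 : ℝ)..Real.pi, ‖q t‖) / k := by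
  set N := ∫ t in (0 : ℝ)..Real.pi, ‖q t‖ with hN
  rw [Complex.ofReal_pow]
  have hpi : Real.pi ∈ Set.Icc 0 Real.pi := Set.right_mem_Icc.2 Real.pi_pos.le
  have hθ := hq.isHillSolution_hillSolution ((k : ℂ) ^ 2) (1, 0)
  have hφ := hq.isHillSolution_hillSolution ((k : ℂ) ^ 2) (0, 1)
  have hk2 : ((-k : ℝ) : ℂ) ^ 2 = (k : ℂ) ^ 2 := by push_cast; ring
  have hMθ : ∀ x ∈ Set.Icc 0 Real.pi, ‖(hillSolution q ((k : ℂ) ^ 2) (1, 0) x).1‖ ≤ 2 :=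
    fun x hx => by
    have := hθ.norm_fst_le_of_large hq hk hkN hx
    rw [hq.hillSolution_zero] at this
    simpa [hk.ne'] using this
  have hMφ : ∀ x ∈ Set.Icc 0 Real.pi, ‖(hillSolution q ((k : ℂ) ^ 2) (0, 1) x).1‖ ≤ 2 / k :=
    fun x hx => by
    have := hφ.norm_fst_le_of_large hq hk hkN hx
    rw [hq.hillSolution_zero] at this
    simpa using this
  have a1 := hθ.norm_exp_mul_sub_le hq hMθ hpi
  have a2 := IsHillSolution.norm_exp_mul_sub_le hq (κ := -k) (by rwa [hk2]) hMθ hpi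
  have b1 := hφ.norm_exp_mul_sub_le hq hMφ hpi
  have b2 := IsHillSolution.norm_exp_mul_sub_le hq (κ := -k) (by rwa [hk2]) hMφ hpi
  rw [IsHillSolution.hillDeriv_pi hq, hq.hillSolution_zero] at a1 a2 b1 b2
  rw [hillDiscriminant]
  set a := (hillSolution q ((k : ℂ) ^ 2) (1, 0) Real.pi).1
  set c := (hillSolution q ((k : ℂ) ^ 2) (1, 0) Real.pi).2
  set b := (hillSolution q ((k : ℂ) ^ 2) (0, 1) Real.pi).1
  set d := (hillSolution q ((k : ℂ) ^ 2) (0, 1) Real.pi).2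
  simp only [mul_one, mul_zero, zero_add, add_zero, Complex.ofReal_neg, mul_neg, neg_mul,
    neg_neg] at a1 a2 b1 b2
  set E := Complex.exp (Complex.I * k * Real.pi) with hE
  set E' := Complex.exp (-(Complex.I * k * Real.pi)) with hE'
  have hEE : E * E' = 1 := by rw [hE, hE', ← Complex.exp_add, add_neg_cancel, Complex.exp_zero]
  have hcos : ((2 * Real.cos (k * Real.pi) : ℝ) : ℂ) = E + E' := by
    rw [hE, hE']
    push_cast
    rw [Complex.two_cos]
    congr 2 <;> ring
  have nE : ‖E‖ = 1 := by
    rw [hE, show Complex.I * k * Real.pi = ((k * Real.pi : ℝ) : ℂ) * Complex.I by push_cast; ring]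
    exact Complex.norm_exp_ofReal_mul_I _
  have nE' : ‖E'‖ = 1 := by
    rw [hE', show -(Complex.I * k * Real.pi) = ((-(k * Real.pi) : ℝ) : ℂ) * Complex.I by
      push_cast; ring]
    exact Complex.norm_exp_ofReal_mul_I _
  have hkc : (k : ℂ) ≠ 0 := Complex.ofReal_ne_zero.2 hk.ne'
  -- The right side consists of the four quantities bounded by `a1`, `a2`, `b1`, `b2`. With the a
  -- priori bounds `2` and `2/k` they contribute `8N` in total.
  have key : 2 * Complex.I * k * (a + d - (E + E')) =
      E * (E' * (c + Complex.I * k * a) - Complex.I * k) -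
      E' * (E * (c + -(Complex.I * k * a)) - -(Complex.I * k)) +
      Complex.I * k * (E * (E' * (d + Complex.I * k * b) - 1) +
      E' * (E * (d + -(Complex.I * k * b)) - 1)) := by
    linear_combination (-2 * Complex.I * k * a - 2 * Complex.I * k * d) * hEE
  have hn : 2 * k * ‖a + d - (E + E')‖ ≤ N * 2 + N * 2 + k * (N * (2 / k) + N * (2 / k)) := by
    have e : ‖2 * Complex.I * k * (a + d - (E + E'))‖ = 2 * k * ‖a + d - (E + E')‖ := by
      rw [norm_mul, norm_mul, norm_mul, Complex.norm_I, Complex.norm_real,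
        Real.norm_of_nonneg hk.le]
      simp
    rw [← e, key]
    refine (norm_add_le _ _).trans (add_le_add ((norm_sub_le _ _).trans (add_le_add ?_ ?_)) ?_)
    · rwa [norm_mul, nE, one_mul]
    · rwa [norm_mul, nE', one_mul]
    · rw [norm_mul, norm_mul, Complex.norm_I, one_mul, Complex.norm_real,
        Real.norm_of_nonneg hk.le]
      refine mul_le_mul_of_nonneg_left ((norm_add_le _ _).trans (add_le_add ?_ ?_)) hk.le
      · rwa [norm_mul, nE, one_mul]
      · rwa [norm_mul, nE', one_mul]
  rw [hcos, le_div_iff₀ hk]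
  have e2 : k * (N * (2 / k) + N * (2 / k)) = 4 * N := by field_simp; ring
  rw [e2] at hn
  linarith

/-! ### The spectrum of the Hill operator -/

theorem mem_hillGraph_iff {q : ℝ → ℂ} {p : L2R × L2R} :
    p ∈ hillGraph q ↔ ∃ y : (hillOperator q).domain, (y : L2R) = p.1 ∧ hillOperator q y = p.2 := by
  rw [← hillOperator_graph, LinearPMap.mem_graph_iff]

/-- Weyl's criterion: a bounded inverse `S` would give `‖y‖ ≤ ‖S‖ ‖(T - z) y‖`. -/
theorem mem_unboundedSpectrum_of_forall {q : ℝ → ℂ} {z : ℂ}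
    (h : ∀ C : ℝ, ∃ p ∈ hillGraph q, C * ‖p.2 - z • p.1‖ < ‖p.1‖) :
    z ∈ unboundedSpectrum (hillOperator q) := by
  rintro ⟨S, -, hS⟩
  obtain ⟨p, hp, hlt⟩ := h ‖S‖
  obtain ⟨y, hy1, hy2⟩ := mem_hillGraph_iff.1 hp
  have h1 := hS y
  rw [hy1, hy2] at h1
  have h2 := S.le_opNorm (p.2 - z • p.1)
  rw [h1] at h2
  exact absurd hlt (not_lt.2 h2)

theorem notMem_unboundedSpectrum {q : ℝ → ℂ} {z : ℂ} {C : ℝ}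
    (hsurj : ∀ f : L2R, ∃ y : L2R, (y, f + z • y) ∈ hillGraph q ∧ ‖y‖ ≤ C * ‖f‖)
    (hinj : ∀ y : L2R, (y, z • y) ∈ hillGraph q → y = 0) :
    z ∉ unboundedSpectrum (hillOperator q) := by
  choose S hS hSC using hsurj
  -- Uniqueness makes the chosen solution map linear.
  have huniq : ∀ f y : L2R, (y, f + z • y) ∈ hillGraph q → y = S f := by
    intro f y hy
    refine sub_eq_zero.1 (hinj _ ?_)
    have h1 := (hillGraph q).sub_mem hy (hS f)
    rw [Prod.mk_sub_mk] at h1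
    convert h1 using 2
    rw [smul_sub]
    abel
  let T : L2R →ₗ[ℂ] L2R :=
    { toFun := S
      map_add' := fun f g => by
        refine (huniq _ _ ?_).symm
        have h1 := (hillGraph q).add_mem (hS f) (hS g)
        rw [Prod.mk_add_mk] at h1
        convert h1 using 2
        rw [smul_add]
        abel
      map_smul' := fun c f => by
        refine (huniq _ _ ?_).symm
        have h1 := (hillGraph q).smul_mem c (hS f)
        rw [Prod.smul_mk] at h1
        rw [smul_add, smul_comm] at h1
        exact h1 }
  have hT : ∀ f, T.mkContinuous C hSC f = S f := fun f => rfl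
  refine not_not.2 ⟨T.mkContinuous C hSC, fun f => ?_, fun y => ?_⟩
  · obtain ⟨y, hy1, hy2⟩ := mem_hillGraph_iff.1 (hS f)
    have hy1 : (y : L2R) = S f := hy1
    refine ⟨by rw [hT, ← hy1]; exact y.2, ?_⟩
    have e : (⟨T.mkContinuous C hSC f, by rw [hT, ← hy1]; exact y.2⟩ : (hillOperator q).domain) = y :=
      Subtype.ext hy1.symm
    rw [e, hy2, hT]
    exact add_sub_cancel_right f (z • S f)
  · rw [hT]
    refine (huniq _ _ ?_).symm
    rw [mem_hillGraph_iff]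
    exact ⟨y, rfl, (sub_add_cancel _ _).symm⟩

/-! ### Floquet solutions with unimodular multiplier -/

/-- Subtracting a translate of `η` yields a plateau of arbitrary length whose derivatives are
bounded independently of the length. -/
theorem exists_smooth_step : ∃ η η₁ η₂ : ℝ → ℝ, ∃ B : ℝ,
    (∀ x, HasDerivAt η (η₁ x) x) ∧ (∀ x, HasDerivAt η₁ (η₂ x) x) ∧ Continuous η₂ ∧
    (∀ x ≤ 0, η x = 0) ∧ (∀ x, Real.pi ≤ x → η x = 1) ∧
    (∀ x ∉ Set.Icc 0 Real.pi, η₁ x = 0 ∧ η₂ x = 0) ∧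
    ∀ x, |η₁ x| ≤ B ∧ |η₂ x| ≤ B := by
  set η : ℝ → ℝ := fun x => Real.smoothTransition (x / Real.pi) with hη
  have hc : ContDiff ℝ 2 η := Real.smoothTransition.contDiff.comp (by fun_prop)
  have hc1 : ContDiff ℝ 1 (deriv η) := by
    rw [show (2 : WithTop ℕ∞) = 1 + 1 by norm_num, contDiff_succ_iff_deriv] at hc
    exact hc.2.2
  have hc2 : Continuous (deriv (deriv η)) := hc1.continuous_deriv le_rfl
  have h0 : ∀ x ≤ 0, η x = 0 := fun x hx =>
    Real.smoothTransition.zero_of_nonpos (div_nonpos_of_nonpos_of_nonneg hx Real.pi_pos.le)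
  have h1 : ∀ x, Real.pi ≤ x → η x = 1 := fun x hx =>
    Real.smoothTransition.one_of_one_le ((one_le_div Real.pi_pos).2 hx)
  have hout : ∀ x ∉ Set.Icc 0 Real.pi, deriv η x = 0 := by
    intro x hx
    by_cases hx0 : x < 0
    · have : η =ᶠ[nhds x] fun _ => 0 := by
        filter_upwards [Iio_mem_nhds hx0] with y hy using h0 y (le_of_lt hy)
      rw [this.deriv_eq, deriv_const]
    · have hxp : Real.pi < x := by
        by_contra hcon
        exact hx ⟨not_lt.1 hx0, not_lt.1 hcon⟩
      have : η =ᶠ[nhds x] fun _ => 1 := by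
        filter_upwards [Ioi_mem_nhds hxp] with y hy using h1 y (le_of_lt hy)
      rw [this.deriv_eq, deriv_const]
  have hout2 : ∀ x ∉ Set.Icc 0 Real.pi, deriv (deriv η) x = 0 := by
    intro x hx
    have : deriv η =ᶠ[nhds x] fun _ => 0 := by
      filter_upwards [isClosed_Icc.isOpen_compl.mem_nhds hx] with y hy using hout y hy
    rw [this.deriv_eq, deriv_const]
  obtain ⟨B₁, hB₁⟩ := (isCompact_Icc (a := (0 : ℝ)) (b := Real.pi)).exists_bound_of_continuousOn
    hc1.continuous.continuousOn
  obtain ⟨B₂, hB₂⟩ := (isCompact_Icc (a := (0 : ℝ)) (b := Real.pi)).exists_bound_of_continuousOn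
    hc2.continuousOn
  refine ⟨η, deriv η, deriv (deriv η), max B₁ B₂,
    fun x => (hc.differentiable (by norm_num) x).hasDerivAt,
    fun x => (hc1.differentiable (by norm_num) x).hasDerivAt, hc2, h0, h1,
    fun x hx => ⟨hout x hx, hout2 x hx⟩, fun x => ?_⟩
  have h0B : 0 ≤ B₁ := (norm_nonneg _).trans (hB₁ 0 (Set.left_mem_Icc.2 Real.pi_pos.le))
  by_cases hx : x ∈ Set.Icc 0 Real.pi
  · exact ⟨(hB₁ x hx).trans (le_max_left _ _), (hB₂ x hx).trans (le_max_right _ _)⟩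
  · rw [hout x hx, hout2 x hx, abs_zero]
    exact ⟨h0B.trans (le_max_left _ _), h0B.trans (le_max_left _ _)⟩

theorem norm_toLp_two_sq {f : ℝ → ℂ} (hf : MemLp f 2 (volume : Measure ℝ)) :
    ‖hf.toLp f‖ ^ 2 = ∫ x, ‖f x‖ ^ 2 := by
  have h1 : (0 : ℝ) ≤ ∫ x, ‖f x‖ ^ 2 := integral_nonneg fun x => by positivity
  rw [Lp.norm_toLp, hf.eLpNorm_eq_integral_rpow_norm (by norm_num) (by norm_num)]
  simp only [ENNReal.toReal_ofNat, Real.rpow_ofNat]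
  rw [ENNReal.toReal_ofReal (by positivity), ← Real.rpow_natCast, ← Real.rpow_mul h1]
  norm_num

theorem exists_norm_le_of_periodic_norm {g : ℝ → ℂ} (hg : Continuous g)
    (hper : ∀ x, ‖g (x + Real.pi)‖ = ‖g x‖) : ∃ D, ∀ x, ‖g x‖ ≤ D := by
  have h1 : Function.Periodic (fun x => ‖g x‖) Real.pi := hper
  obtain ⟨D, hD⟩ := (h1.isBounded_of_continuous Real.pi_ne_zero hg.norm).exists_norm_le
  exact ⟨D, fun x => by simpa using hD _ (Set.mem_range_self x)⟩

theorem IsHillSolution.hillDeriv_add_pi {q : ℝ → ℂ} (hq : HillPotential q) {Y : ℝ → ℂ × ℂ}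
    {ρ : ℂ} (hper : ∀ x, Y (x + Real.pi) = ρ • Y x) (x : ℝ) :
    hillDeriv q Y (x + Real.pi) = ρ * hillDeriv q Y x := by
  simp only [hillDeriv, hper, hq.primitive_periodic x, Prod.smul_fst, Prod.smul_snd, smul_eq_mul]
  ring

/-- For a plateau cut-off `χ`, the error `χ'' y + 2 χ' y'` lives on two transition intervals and
stays bounded in `L₂`, since `y` and `y'` are bounded. The norm of `χ y` grows with the number of
periods in the plateau. -/
theorem HillPotential.mem_spectrum_of_unimodular {q : ℝ → ℂ} (hq : HillPotential q) {z ρ : ℂ}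
    {Y : ℝ → ℂ × ℂ} (hY : IsHillSolution q z Y) (h0 : Y 0 ≠ 0)
    (hper : ∀ x, Y (x + Real.pi) = ρ • Y x) (hρ : ‖ρ‖ = 1) :
    z ∈ unboundedSpectrum (hillOperator q) := by
  obtain ⟨η, η₁, η₂, B, hη, hη₁, hcη₂, hη0, hη1, hout, hB⟩ := exists_smooth_step
  set y : ℝ → ℂ := fun x => (Y x).1 with hy
  set y' : ℝ → ℂ := hillDeriv q Y with hy'
  have hyd : ∀ x, HasDerivAt y (y' x) x := hY.hasDerivAt_fst
  have hyc : Continuous y := hY.continuous.fst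
  have hyc' : Continuous y' := hY.continuous_hillDeriv hq
  have hyper : ∀ x, ‖y (x + Real.pi)‖ = ‖y x‖ := fun x => by
    simp only [hy]
    rw [hper, Prod.smul_fst, norm_smul, hρ, one_mul]
  have hyper' : ∀ x, ‖y' (x + Real.pi)‖ = ‖y' x‖ := fun x => by
    simp only [hy']
    rw [IsHillSolution.hillDeriv_add_pi hq hper, norm_mul, hρ, one_mul]
  obtain ⟨D, hD⟩ := exists_norm_le_of_periodic_norm hyc hyper
  obtain ⟨D', hD'⟩ := exists_norm_le_of_periodic_norm hyc' hyper'
  have hcη : Continuous η := continuous_iff_continuousAt.2 fun x => (hη x).continuousAt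
  have hcη₁ : Continuous η₁ := continuous_iff_continuousAt.2 fun x => (hη₁ x).continuousAt
  set c := ∫ x in (0 : ℝ)..Real.pi, ‖y x‖ ^ 2 with hc
  have hcpos : 0 < c := by
    obtain ⟨x, hx, hx0⟩ := hY.exists_fst_ne_zero hq h0 Real.pi_pos
    refine intervalIntegral.integral_pos Real.pi_pos (by fun_prop) (fun _ _ => by positivity)
      ⟨x, Set.Ioo_subset_Icc_self hx, ?_⟩
    have : y x ≠ 0 := hx0
    positivity
  set E := 2 * B * D + 2 * (2 * B * D') with hE
  refine mem_unboundedSpectrum_of_forall fun C => ?_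
  obtain ⟨n, hn⟩ := exists_nat_gt (C ^ 2 * (E ^ 2 * (2 * Real.pi)) / c)
  rw [div_lt_iff₀ hcpos] at hn
  set a : ℝ := (n + 1) * Real.pi with ha
  have hπ := Real.pi_pos
  -- The plateau `[π, a]` contains exactly `n` periods, each contributing `c` to the squared norm.
  have ha0 : Real.pi ≤ a := by rw [ha]; nlinarith [n.cast_nonneg (α := ℝ)]
  set χ : ℝ → ℂ := fun x => ((η x - η (x - a) : ℝ) : ℂ) with hχ
  set χ₁ : ℝ → ℂ := fun x => ((η₁ x - η₁ (x - a) : ℝ) : ℂ) with hχ₁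
  set χ₂ : ℝ → ℂ := fun x => ((η₂ x - η₂ (x - a) : ℝ) : ℂ) with hχ₂
  have hχd : ∀ x, HasDerivAt χ (χ₁ x) x := fun x =>
    ((hη x).fun_sub ((hη (x - a)).comp_sub_const x a)).ofReal_comp
  have hχd₁ : ∀ x, HasDerivAt χ₁ (χ₂ x) x := fun x =>
    ((hη₁ x).fun_sub ((hη₁ (x - a)).comp_sub_const x a)).ofReal_comp
  have hcχ : Continuous χ := by rw [hχ]; fun_prop
  have hcχ₁ : Continuous χ₁ := by rw [hχ₁]; fun_prop
  have hcχ₂ : Continuous χ₂ := by rw [hχ₂]; fun_prop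
  set S : Set ℝ := Set.Icc 0 Real.pi ∪ Set.Icc a (a + Real.pi) with hS
  have hχ0 : ∀ x ∉ Set.Icc 0 (a + Real.pi), χ x = 0 := by
    intro x hx
    rw [Set.mem_Icc, not_and_or, not_le, not_le] at hx
    rcases hx with hx | hx
    · simp only [hχ, hη0 x hx.le, hη0 (x - a) (by linarith), sub_zero, Complex.ofReal_zero]
    · simp only [hχ, hη1 x (by linarith), hη1 (x - a) (by linarith), sub_self, Complex.ofReal_zero]
  have hχS : ∀ x ∉ S, χ₁ x = 0 ∧ χ₂ x = 0 := by
    intro x hx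
    rw [hS, Set.mem_union, not_or] at hx
    have h1 := hout x hx.1
    have h2 := hout (x - a) (fun hm => hx.2 ⟨by linarith [hm.1], by linarith [hm.2]⟩)
    simp only [hχ₁, hχ₂, h1.1, h1.2, h2.1, h2.2, sub_zero, Complex.ofReal_zero, and_self]
  have hSsub : S ⊆ Set.Icc 0 (a + Real.pi) := by
    rintro x (hx | hx)
    · exact ⟨hx.1, by linarith [hx.2]⟩
    · exact ⟨by linarith [hx.1], hx.2⟩
  set u : ℝ → ℂ := fun x => χ x * y x with hu
  set e : ℝ → ℂ := fun x => χ₂ x * y x + 2 * (χ₁ x * y' x) with he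
  have hcu : Continuous u := hcχ.mul hyc
  have hce : Continuous e := by rw [he]; fun_prop
  have hu0 : ∀ x ∉ Set.Icc 0 (a + Real.pi), u x = 0 := fun x hx => by
    simp only [hu, hχ0 x hx, zero_mul]
  have he0 : ∀ x ∉ S, e x = 0 := fun x hx => by
    simp only [he, (hχS x hx).1, (hχS x hx).2, zero_mul, mul_zero, add_zero]
  have hu2 : MemLp u 2 volume := hcu.memLp_of_hasCompactSupport
    (HasCompactSupport.intro isCompact_Icc hu0)
  have he2 : MemLp e 2 volume := hce.memLp_of_hasCompactSupport
    (HasCompactSupport.intro isCompact_Icc fun x hx => he0 x fun h => hx (hSsub h))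
  refine ⟨(hu2.toLp u, z • hu2.toLp u - he2.toLp e), ⟨u, fun x => χ₁ x * y x + χ x * y' x,
    hu2.coeFn_toLp, fun x => (hχd x).fun_mul (hyd x), fun α β => ?_, ?_⟩, ?_⟩
  · exact ((absolutelyContinuousOnInterval_of_hasDerivAt hχd₁ hcχ₂ α β).fun_smul
      (hY.absolutelyContinuous_fst hq α β)).fun_add
      ((absolutelyContinuousOnInterval_of_hasDerivAt hχd hcχ₁ α β).fun_smul
      (hY.absolutelyContinuous_hillDeriv hq α β))
  · filter_upwards [hY.ae_hasDerivAt_hillDeriv hq, Lp.coeFn_sub (z • hu2.toLp u) (he2.toLp e),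
      Lp.coeFn_smul z (hu2.toLp u), hu2.coeFn_toLp, he2.coeFn_toLp] with x h1 h2 h3 h4 h5
    refine (((hχd₁ x).fun_mul (hyd x)).fun_add ((hχd x).fun_mul h1)).congr_deriv ?_
    rw [h2, Pi.sub_apply, h3, Pi.smul_apply, h4, h5, smul_eq_mul]
    simp only [hu, he, hy]
    ring
  · change C * ‖z • hu2.toLp u - he2.toLp e - z • hu2.toLp u‖ < ‖hu2.toLp u‖
    rw [sub_sub_cancel_left, norm_neg]
    refine abs_lt_of_sq_lt_sq' ?_ (norm_nonneg _) |>.2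
    rw [mul_pow, norm_toLp_two_sq, norm_toLp_two_sq]
    have hSm : MeasurableSet S := measurableSet_Icc.union measurableSet_Icc
    have hSv : volume S < ⊤ := (measure_mono hSsub).trans_lt measure_Icc_lt_top
    have hSv2 : volume.real S ≤ 2 * Real.pi := by
      refine (measureReal_union_le _ _).trans ?_
      rw [Real.volume_real_Icc_of_le hπ.le, Real.volume_real_Icc_of_le (by linarith)]
      linarith
    have hupper : ∫ x, ‖e x‖ ^ 2 ≤ E ^ 2 * (2 * Real.pi) := by
      have h1 : ∫ x, ‖e x‖ ^ 2 ≤ ∫ x, S.indicator (fun _ => E ^ 2) x := by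
        refine integral_mono (he2.integrable_norm_pow (by norm_num))
          ((integrable_indicator_iff hSm).2 (integrableOn_const hSv.ne)) fun x => ?_
        by_cases hx : x ∈ S
        · rw [Set.indicator_of_mem hx]
          have hb₁ : ‖χ₁ x‖ ≤ 2 * B := by
            simp only [hχ₁, Complex.norm_real]
            refine (norm_sub_le _ _).trans ?_
            have := (hB x).1; have := (hB (x - a)).1
            simp only [Real.norm_eq_abs]; linarith
          have hb₂ : ‖χ₂ x‖ ≤ 2 * B := by
            simp only [hχ₂, Complex.norm_real]
            refine (norm_sub_le _ _).trans ?_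
            have := (hB x).2; have := (hB (x - a)).2
            simp only [Real.norm_eq_abs]; linarith
          have hB0 : 0 ≤ 2 * B := (norm_nonneg _).trans hb₁
          refine pow_le_pow_left₀ (norm_nonneg _) ?_ 2
          refine (norm_add_le _ _).trans ?_
          rw [norm_mul, norm_mul, norm_mul, Complex.norm_ofNat, hE]
          have := hD x; have := hD' x
          gcongr
        · simp only [Set.indicator_of_notMem hx, he0 x hx, norm_zero]
          norm_num
      rw [integral_indicator hSm, setIntegral_const, smul_eq_mul] at h1
      refine h1.trans ?_
      rw [mul_comm]
      gcongr
    have hlower : n * c ≤ ∫ x, ‖u x‖ ^ 2 := by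
      have hint := hu2.integrable_norm_pow (p := 2) (by norm_num)
      have h1 : ∫ x in Set.Ioc Real.pi (Real.pi + n • Real.pi), ‖y x‖ ^ 2 =
          ∫ x in Set.Ioc Real.pi (Real.pi + n • Real.pi), ‖u x‖ ^ 2 := by
        refine setIntegral_congr_fun measurableSet_Ioc fun x hx => ?_
        have hx2 : x ≤ a := by
          have := hx.2
          rw [nsmul_eq_mul] at this
          rw [ha]; linarith
        simp only [hu, hχ, hη1 x hx.1.le, hη0 (x - a) (by linarith), sub_zero,
          Complex.ofReal_one, one_mul]
      have h2 : ∫ x in Real.pi..(Real.pi + n • Real.pi), ‖y x‖ ^ 2 = n * c := by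
        have hp : Function.Periodic (fun x => ‖y x‖ ^ 2) Real.pi := fun x => by
          simp only [hyper x]
        have h3 := hp.intervalIntegral_add_zsmul_eq n Real.pi
          (fun t₁ t₂ => Continuous.intervalIntegrable (by fun_prop) _ _)
        rw [natCast_zsmul, natCast_zsmul, nsmul_eq_mul] at h3
        rw [nsmul_eq_mul] at h3 ⊢
        rw [h3, hp.intervalIntegral_add_eq Real.pi 0, zero_add, hc]
      rw [← h2, intervalIntegral.integral_of_le (by
        rw [nsmul_eq_mul]; nlinarith [n.cast_nonneg (α := ℝ)]), h1]
      exact setIntegral_le_integral hint (Filter.Eventually.of_forall fun x => by positivity)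
    calc C ^ 2 * ∫ x, ‖e x‖ ^ 2 ≤ C ^ 2 * (E ^ 2 * (2 * Real.pi)) := by gcongr
      _ < n * c := hn
      _ ≤ _ := hlower

/-! ### A convolution estimate -/

theorem sq_lintegral_mul_le {α : Type*} [MeasurableSpace α] (μ : Measure α) {k g : α → ENNReal}
    (hk : Measurable k) (hg : Measurable g) :
    (∫⁻ t, k t * g t ∂μ) ^ 2 ≤ (∫⁻ t, k t ∂μ) * ∫⁻ t, k t * g t ^ 2 ∂μ := by
  have h := ENNReal.lintegral_mul_le_Lp_mul_Lq μ Real.HolderConjugate.two_two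
    (f := fun t => k t ^ (1 / 2 : ℝ)) (g := fun t => k t ^ (1 / 2 : ℝ) * g t)
    (hk.pow_const _).aemeasurable ((hk.pow_const _).mul hg).aemeasurable
  have e0 : ∀ a : ENNReal, a ^ (1 / 2 : ℝ) * a ^ (1 / 2 : ℝ) = a := fun a => by
    rw [← ENNReal.rpow_add_of_nonneg _ _ (by norm_num) (by norm_num)]
    norm_num
  have e1 : ∀ a : ENNReal, (a ^ (1 / 2 : ℝ)) ^ (2 : ℝ) = a := fun a => by
    rw [← ENNReal.rpow_mul]
    norm_num
  have e2 : ∀ a : ENNReal, (a ^ (1 / 2 : ℝ)) ^ 2 = a := fun a => by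
    rw [← ENNReal.rpow_two, e1]
  simp only [Pi.mul_apply, ENNReal.mul_rpow_of_nonneg _ _ zero_le_two, e1, ← mul_assoc, e0] at h
  refine (pow_le_pow_left' h 2).trans (le_of_eq ?_)
  rw [mul_pow, e2, e2]
  simp only [ENNReal.rpow_two]

/-- Young's inequality for `L₁ * L₂`: Cauchy–Schwarz with weight `k`, then Tonelli and translation
invariance. -/
theorem lintegral_sq_convolution_le {k g : ℝ → ENNReal} (hk : Measurable k) (hg : Measurable g) :
    ∫⁻ x, (∫⁻ t, k (x - t) * g t) ^ 2 ≤ (∫⁻ t, k t) ^ 2 * ∫⁻ t, g t ^ 2 := by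
  have hk1 : Measurable fun p : ℝ × ℝ => k (p.1 - p.2) * g p.2 ^ 2 := by fun_prop
  calc ∫⁻ x, (∫⁻ t, k (x - t) * g t) ^ 2
      ≤ ∫⁻ x, (∫⁻ t, k t) * ∫⁻ t, k (x - t) * g t ^ 2 := by
        refine lintegral_mono fun x => ?_
        refine (sq_lintegral_mul_le volume (k := fun t => k (x - t)) (by fun_prop) hg).trans ?_
        rw [lintegral_sub_left_eq_self k x]
    _ = (∫⁻ t, k t) * ∫⁻ t, ∫⁻ x, k (x - t) * g t ^ 2 := by
        rw [lintegral_const_mul _ hk1.lintegral_prod_right', lintegral_lintegral_swap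
          hk1.aemeasurable]
    _ = (∫⁻ t, k t) * ∫⁻ t, (∫⁻ x, k x) * g t ^ 2 := by
        congr 2
        funext t
        rw [lintegral_mul_const _ (by fun_prop), lintegral_sub_right_eq_self k t]
    _ = _ := by
        rw [lintegral_const_mul _ (hg.pow_const 2), ← mul_assoc, sq]

theorem eLpNorm_two_le_of_lintegral {u f : ℝ → ℂ} {c : ENNReal}
    (h : ∫⁻ x, ‖u x‖ₑ ^ 2 ≤ c ^ 2 * ∫⁻ x, ‖f x‖ₑ ^ 2) :
    eLpNorm u 2 volume ≤ c * eLpNorm f 2 volume := by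
  have e : ∀ g : ℝ → ℂ, eLpNorm g 2 volume = (∫⁻ x, ‖g x‖ₑ ^ 2) ^ (1 / 2 : ℝ) := fun g => by
    rw [eLpNorm_eq_lintegral_rpow_enorm_toReal (by norm_num) (by norm_num)]
    simp
  rw [e, e]
  refine (ENNReal.rpow_le_rpow h (by norm_num)).trans (le_of_eq ?_)
  rw [ENNReal.mul_rpow_of_nonneg _ _ (by norm_num), ← ENNReal.rpow_two, ← ENNReal.rpow_mul]
  norm_num

theorem integrable_exp_neg_mul_abs {a : ℝ} (ha : 0 < a) :
    Integrable fun x : ℝ => Real.exp (-(a * |x|)) := by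
  rw [← integrableOn_univ, ← Set.Iic_union_Ioi (a := (0 : ℝ))]
  refine IntegrableOn.union ?_ ?_
  · refine (integrableOn_exp_mul_Iic ha 0).congr_fun (fun x hx => ?_) measurableSet_Iic
    simp only
    rw [abs_of_nonpos hx]
    ring_nf
  · refine (exp_neg_integrableOn_Ioi 0 ha).congr_fun (fun x hx => ?_) measurableSet_Ioi
    simp only
    rw [abs_of_pos hx]
    ring_nf

/-! ### Growth of Floquet solutions -/

theorem exists_norm_le_exp_of_multiplier {y : ℝ → ℂ} (hy : Continuous y) {r : ℝ} (hr : 0 < r)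
    (hper : ∀ x, ‖y (x + Real.pi)‖ = r * ‖y x‖) :
    ∃ C, 0 ≤ C ∧ ∀ x, ‖y x‖ ≤ C * Real.exp (Real.log r / Real.pi * x) := by
  set b := Real.log r / Real.pi with hb
  obtain ⟨C, hC⟩ := exists_norm_le_of_periodic_norm
    (g := fun x => (Real.exp (-(b * x)) : ℂ) * y x) (by fun_prop) (fun x => by
      rw [norm_mul, norm_mul, Complex.norm_real, Complex.norm_real, hper,
        Real.norm_of_nonneg (Real.exp_pos _).le, Real.norm_of_nonneg (Real.exp_pos _).le,
        ← mul_assoc]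
      congr 1
      have e1 : -(b * (x + Real.pi)) + Real.log r = -(b * x) := by
        rw [hb]
        field_simp
        ring
      rw [← e1, Real.exp_add, Real.exp_log hr])
  have hC' : ∀ x, ‖y x‖ ≤ C * Real.exp (b * x) := fun x => by
    have h1 := hC x
    rw [norm_mul, Complex.norm_real, Real.norm_of_nonneg (Real.exp_pos _).le, Real.exp_neg,
      inv_mul_le_iff₀ (Real.exp_pos _)] at h1
    linarith
  refine ⟨C, ?_, hC'⟩
  have h1 := (norm_nonneg _).trans (hC' 0)
  simpa using h1

namespace HillPotential

variable {q : ℝ → ℂ}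

/-- Translation by `π` preserves `∫ |y|²` but multiplies it by `|ρ|²`. -/
theorem eq_zero_of_memLp_of_multiplier (hq : HillPotential q) {z ρ : ℂ} {X : ℝ → ℂ × ℂ}
    (hX : IsHillSolution q z X) (hL : MemLp (fun x => (X x).1) 2 volume)
    (hper : ∀ x, X (x + Real.pi) = ρ • X x) (hρ : ‖ρ‖ ≠ 1) : X 0 = 0 := by
  by_contra h0
  obtain ⟨x, -, hx⟩ := hX.exists_fst_ne_zero hq h0 Real.pi_pos
  have hc : Continuous fun x => ‖(X x).1‖ ^ 2 := hX.continuous.fst.norm.pow 2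
  have hpos : 0 < ∫ x, ‖(X x).1‖ ^ 2 :=
    integral_pos_of_integrable_nonneg_nonzero hc (hL.integrable_norm_pow (p := 2) (by norm_num))
      (fun x => by positivity) (x := x) (by simpa using hx)
  have h1 : ∫ x, ‖(X (x + Real.pi)).1‖ ^ 2 = ∫ x, ‖(X x).1‖ ^ 2 :=
    integral_add_right_eq_self (fun x => ‖(X x).1‖ ^ 2) Real.pi
  simp only [hper, Prod.smul_fst, norm_smul, mul_pow, integral_const_mul] at h1
  have h2 : ‖ρ‖ ^ 2 = 1 := by
    rw [mul_eq_right₀ hpos.ne'] at h1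
    exact h1
  exact hρ ((pow_eq_one_iff_of_nonneg (norm_nonneg _) two_ne_zero).1 h2)

/-- Cayley–Hamilton for the monodromy matrix. -/
theorem add_two_pi (hq : HillPotential q) {z : ℂ} {X : ℝ → ℂ × ℂ}
    (hX : IsHillSolution q z X) (x : ℝ) :
    X (x + Real.pi + Real.pi) = hillDiscriminant q z • X (x + Real.pi) - X x := by
  have h1 := hq.solution_add_pi hX
  have h2 := hq.solution_add_pi h1
  have h3 := (h1.smul (hillDiscriminant q z)).add (hX.smul (-1))
  have h4 := hq.solution_unique h2 h3 (x := 0) ?_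
  · rw [congrFun h4 x, neg_one_smul, sub_eq_add_neg]
  · have hdet := hq.monodromy_det z
    have s1 := hq.solution_eq h1 Real.pi
    have s2 := hq.solution_eq hX Real.pi
    simp only [zero_add] at s1 ⊢
    rw [s1, s2, hillDiscriminant]
    refine Prod.ext ?_ ?_
    · simp
      linear_combination (-(X 0).1) * hdet
    · simp
      linear_combination (-(X 0).2) * hdet

/-- With `T` the translation by `π`, Cayley–Hamilton reads `(T - ρ⁻¹)(T - ρ) X = 0`. So `(T - ρ) X`
is square integrable with multiplier `ρ⁻¹` and vanishes; then `X` itself has multiplier `ρ`. -/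
theorem eq_zero_of_memLp (hq : HillPotential q) {z ρ : ℂ} {X : ℝ → ℂ × ℂ}
    (hX : IsHillSolution q z X) (hL : MemLp (fun x => (X x).1) 2 volume)
    (hρ : ρ ^ 2 - hillDiscriminant q z * ρ + 1 = 0) (hρ1 : ‖ρ‖ ≠ 1) : X 0 = 0 := by
  have hρ0 : ρ ≠ 0 := fun h => by simp [h] at hρ
  have hF : hillDiscriminant q z = ρ + ρ⁻¹ := by
    field_simp
    linear_combination -hρ
  have hG := (hq.solution_add_pi hX).add (hX.smul (-ρ))
  have hLs : MemLp (fun x => (X (x + Real.pi)).1) 2 volume :=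
    hL.comp_measurePreserving (measurePreserving_add_right volume Real.pi)
  have hG0 := hq.eq_zero_of_memLp_of_multiplier hG (ρ := ρ⁻¹) (hLs.add (hL.const_mul (-ρ)))
    (fun x => by
      rw [hq.add_two_pi hX, hF]
      refine Prod.ext ?_ ?_
      · simp
        field_simp
        ring
      · simp
        field_simp
        ring) (by rw [norm_inv]; simpa using hρ1)
  refine hq.eq_zero_of_memLp_of_multiplier hX hL (ρ := ρ) (fun x => ?_) hρ1
  refine congrFun (hq.solution_unique (hq.solution_add_pi hX) (hX.smul ρ) (x := 0) ?_) x
  rw [neg_smul, ← sub_eq_add_neg, sub_eq_zero] at hG0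
  exact hG0

/-- Proportional solutions would have equal multipliers. -/
theorem wronskian_ne_zero (hq : HillPotential q) {z ρ : ℂ} {Y Z : ℝ → ℂ × ℂ}
    (hY : IsHillSolution q z Y) (hZ : IsHillSolution q z Z) (hY0 : Y 0 ≠ 0) (hZ0 : Z 0 ≠ 0)
    (hYper : ∀ x, Y (x + Real.pi) = ρ • Y x) (hZper : ∀ x, Z (x + Real.pi) = ρ⁻¹ • Z x)
    (hρ : ρ ≠ ρ⁻¹) : (Y 0).1 * (Z 0).2 - (Y 0).2 * (Z 0).1 ≠ 0 := by
  intro hW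
  have key : ∀ a b : ℂ, a • Y 0 = b • Z 0 → a = 0 := by
    intro a b hab
    have h1 := congrFun (hq.solution_unique (hY.smul a) (hZ.smul b) (x := 0) hab) (0 + Real.pi)
    rw [hYper, hZper, smul_comm, hab, smul_comm b, ← hab, ← sub_eq_zero, ← sub_smul,
      smul_eq_zero, smul_eq_zero, sub_eq_zero] at h1
    rcases h1 with h1 | h1 | h1
    · exact absurd h1 hρ
    · exact h1
    · exact absurd h1 hY0
  have h1 := key (Z 0).2 (Y 0).2 (Prod.ext (by simp; linear_combination hW) (by simp; ring))
  have h2 := key (Z 0).1 (Y 0).1 (Prod.ext (by simp; ring) (by simp; linear_combination -hW))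
  exact hZ0 (Prod.ext h2 h1)

end HillPotential

/-! ### The resolvent as an integral operator -/

theorem integrableOn_mul_of_exp_bound {a K x : ℝ} (ha : 0 < a) {S : Set ℝ}
    (hS : MeasurableSet S) {y f : ℝ → ℂ} (hy : Continuous y) (hf : MemLp f 2 volume)
    (h : ∀ t ∈ S, ‖y t‖ ≤ K * Real.exp (-(a * |x - t|))) :
    IntegrableOn (fun t => y t * f t) S := by
  have hexp : MemLp (fun t : ℝ => Real.exp (-(a * |x - t|))) 2 volume := by
    rw [memLp_two_iff_integrable_sq_norm (by fun_prop)]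
    have h1 := (integrable_exp_neg_mul_abs (a := 2 * a) (by positivity)).comp_sub_left x
    refine h1.congr (Filter.Eventually.of_forall fun t => ?_)
    simp only
    rw [Real.norm_of_nonneg (Real.exp_pos _).le, ← Real.exp_nat_mul]
    congr 1
    push_cast
    ring
  have hint : Integrable (fun t => K * (Real.exp (-(a * |x - t|)) * ‖f t‖)) :=
    (hexp.integrable_mul hf.norm).const_mul K
  refine hint.integrableOn.mono'
    (hy.aestronglyMeasurable.mul hf.aestronglyMeasurable.restrict) ?_
  filter_upwards [ae_restrict_mem hS] with t ht
  rw [norm_mul, ← mul_assoc]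
  exact mul_le_mul_of_nonneg_right (h t ht) (norm_nonneg _)

theorem enorm_mul_setIntegral_le {a K x : ℝ} {S : Set ℝ} (hS : MeasurableSet S) {c : ℂ}
    {y f : ℝ → ℂ} (h : ∀ t ∈ S, ‖c‖ * ‖y t‖ ≤ K * Real.exp (-(a * |x - t|))) :
    ‖c * ∫ t in S, y t * f t‖ₑ ≤
      ∫⁻ t, ENNReal.ofReal (K * Real.exp (-(a * |x - t|))) * ‖f t‖ₑ := by
  rw [← integral_const_mul]
  refine (enorm_integral_le_lintegral_enorm _).trans ?_
  refine (setLIntegral_mono' hS fun t ht => ?_).trans (setLIntegral_le_lintegral S _)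
  rw [← mul_assoc, enorm_mul]
  gcongr
  rw [← ofReal_norm, norm_mul]
  exact ENNReal.ofReal_le_ofReal (h t ht)

theorem hasDerivAt_of_ae_hasDerivAt {A g : ℝ → ℂ} (hg : ∀ a b, IntervalIntegrable g volume a b)
    {A₀ : ℂ} (hA : ∀ x, A x = A₀ + ∫ t in (0 : ℝ)..x, g t) :
    (∀ a b, AbsolutelyContinuousOnInterval A a b) ∧ Continuous A ∧
      ∀ᵐ x, HasDerivAt A (g x) x := by
  have e : A = fun x => A₀ + ∫ t in (0 : ℝ)..x, g t := funext hA
  refine ⟨fun a b => ?_, ?_, ?_⟩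
  · rw [e]
    exact (LipschitzWith.const A₀).lipschitzOnWith.absolutelyContinuousOnInterval.fun_add
      (absolutelyContinuousOnInterval_integral_complex hg 0 a b)
  · rw [e]
    exact continuous_const.add (intervalIntegral.continuous_primitive hg 0)
  · rw [e]
    filter_upwards [LocallyIntegrable.ae_hasDerivAt_integral
      (locallyIntegrable_of_intervalIntegrable hg)] with x hx
    exact (hx 0).const_add A₀

theorem intervalIntegrable_continuous_mul_of_memLp {y f : ℝ → ℂ} (hy : Continuous y)
    (hf : MemLp f 2 volume) (a b : ℝ) : IntervalIntegrable (fun t => y t * f t) volume a b := by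
  have h1 : IntervalIntegrable f volume a b := by
    rw [intervalIntegrable_iff]
    have : IsFiniteMeasure (volume.restrict (Set.uIoc a b)) :=
      ⟨by rw [Measure.restrict_apply_univ]; exact measure_Ioc_lt_top⟩
    exact (hf.restrict _).integrable one_le_two
  exact h1.continuousOn_mul hy.continuousOn

/-- Variation of constants. -/
theorem HillPotential.exists_hill_inhomogeneous {q : ℝ → ℂ} (hq : HillPotential q) {z : ℂ}
    {Y Z : ℝ → ℂ × ℂ} (hY : IsHillSolution q z Y) (hZ : IsHillSolution q z Z)
    (hW : (Y 0).1 * (Z 0).2 - (Y 0).2 * (Z 0).1 = 1) {f A B : ℝ → ℂ} (hf : MemLp f 2 volume)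
    {A₀ B₀ : ℂ} (hA : ∀ x, A x = A₀ + ∫ t in (0 : ℝ)..x, (Z t).1 * f t)
    (hB : ∀ x, B x = B₀ + ∫ t in (0 : ℝ)..x, -((Y t).1 * f t)) :
    ∃ v : ℝ → ℂ, (∀ x, HasDerivAt (fun x => (Y x).1 * A x + (Z x).1 * B x) (v x) x) ∧
      (∀ a b, AbsolutelyContinuousOnInterval v a b) ∧
      ∀ᵐ x, HasDerivAt v
        (q x * ((Y x).1 * A x + (Z x).1 * B x) -
          (f x + z * ((Y x).1 * A x + (Z x).1 * B x))) x := by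
  obtain ⟨hA1, hA2, hA3⟩ := hasDerivAt_of_ae_hasDerivAt
    (intervalIntegrable_continuous_mul_of_memLp hZ.continuous.fst hf) hA
  obtain ⟨hB1, hB2, hB3⟩ := hasDerivAt_of_ae_hasDerivAt (g := fun t => -((Y t).1 * f t))
    (fun a b => (intervalIntegrable_continuous_mul_of_memLp hY.continuous.fst hf a b).neg) hB
  have hYc := hY.continuous_hillDeriv hq
  have hZc := hZ.continuous_hillDeriv hq
  have hWx : ∀ x, (Y x).1 * hillDeriv q Z x - hillDeriv q Y x * (Z x).1 = 1 := fun x => by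
    rw [← hW, ← hY.wronskian_eq hZ x, hillDeriv, hillDeriv]
    ring
  refine ⟨fun x => hillDeriv q Y x * A x + hillDeriv q Z x * B x, fun x => ?_, fun a b => ?_, ?_⟩
  -- The contributions of `A'` and `B'` to `u'` cancel, which leaves a continuous function.
  · refine AbsolutelyContinuousOnInterval.hasDerivAt_of_continuous
      (g := fun x => hillDeriv q Y x * A x + hillDeriv q Z x * B x) (fun a b => ?_)
      (by fun_prop) ?_ x
    · exact ((hY.absolutelyContinuous_fst hq a b).fun_smul (hA1 a b)).fun_add
        ((hZ.absolutelyContinuous_fst hq a b).fun_smul (hB1 a b))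
    · filter_upwards [hA3, hB3] with x h1 h2
      exact (((hY.hasDerivAt_fst x).fun_mul h1).fun_add
        ((hZ.hasDerivAt_fst x).fun_mul h2)).congr_deriv (by ring)
  · exact ((hY.absolutelyContinuous_hillDeriv hq a b).fun_smul (hA1 a b)).fun_add
      ((hZ.absolutelyContinuous_hillDeriv hq a b).fun_smul (hB1 a b))
  · filter_upwards [hA3, hB3, hY.ae_hasDerivAt_hillDeriv hq, hZ.ae_hasDerivAt_hillDeriv hq]
      with x h1 h2 h3 h4
    refine ((h3.fun_mul h1).fun_add (h4.fun_mul h2)).congr_deriv ?_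
    linear_combination (-f x) * hWx x

/-- The Floquet solutions `Y` and `Z` for `ρ` and `ρ⁻¹` decay at `+∞` and `-∞` respectively.
Normalized to Wronskian 1 they form a Green's function bounded by `K e^{-a|x-t|}`, so Young's
inequality bounds the resolvent on `L₂`. -/
theorem HillPotential.notMem_spectrum_of_multiplier {q : ℝ → ℂ} (hq : HillPotential q) {z ρ : ℂ}
    (hρ : ρ ^ 2 - hillDiscriminant q z * ρ + 1 = 0) (hlt : ‖ρ‖ < 1) :
    z ∉ unboundedSpectrum (hillOperator q) := by
  have hρ0 : ρ ≠ 0 := fun h => by simp [h] at hρ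
  have hr : 0 < ‖ρ‖ := norm_pos_iff.2 hρ0
  have hρinv : ρ⁻¹ ^ 2 - hillDiscriminant q z * ρ⁻¹ + 1 = 0 := by
    field_simp
    linear_combination hρ
  have hne : ρ ≠ ρ⁻¹ := fun h => by
    have h1 : ‖ρ‖ = ‖ρ‖⁻¹ := by rw [← norm_inv, ← h]
    have h2 := one_lt_inv₀ hr |>.2 hlt
    linarith
  obtain ⟨Y, hY, hY0, hYper⟩ := hq.exists_floquet hρ
  obtain ⟨Z', hZ', hZ0', hZper'⟩ := hq.exists_floquet hρinv
  have hW' := hq.wronskian_ne_zero hY hZ' hY0 hZ0' hYper hZper' hne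
  set W := (Y 0).1 * (Z' 0).2 - (Y 0).2 * (Z' 0).1 with hWdef
  set Z : ℝ → ℂ × ℂ := fun x => W⁻¹ • Z' x with hZdef
  have hZ : IsHillSolution q z Z := hZ'.smul W⁻¹
  have hZper : ∀ x, Z (x + Real.pi) = ρ⁻¹ • Z x := fun x => by
    simp only [hZdef, hZper']
    rw [smul_comm]
  have hW : (Y 0).1 * (Z 0).2 - (Y 0).2 * (Z 0).1 = 1 := by
    simp only [hZdef, Prod.smul_fst, Prod.smul_snd, smul_eq_mul]
    rw [← inv_mul_cancel₀ hW', hWdef]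
    ring
  obtain ⟨C₁, hC₁0, hC₁⟩ := exists_norm_le_exp_of_multiplier hY.continuous.fst hr
    (fun x => by rw [hYper, Prod.smul_fst, norm_smul])
  obtain ⟨C₂, hC₂0, hC₂⟩ := exists_norm_le_exp_of_multiplier hZ.continuous.fst (inv_pos.2 hr)
    (fun x => by rw [hZper, Prod.smul_fst, norm_smul, norm_inv])
  obtain ⟨a, ha, hadef⟩ : ∃ a : ℝ, 0 < a ∧ Real.log ‖ρ‖ / Real.pi = -a :=
    ⟨-(Real.log ‖ρ‖ / Real.pi), neg_pos.2 (div_neg_of_neg_of_pos (Real.log_neg hr hlt) Real.pi_pos),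
      by ring⟩
  rw [hadef] at hC₁
  rw [Real.log_inv, neg_div, hadef, neg_neg] at hC₂
  set K := C₁ * C₂ with hK
  have hK0 : 0 ≤ K := mul_nonneg hC₁0 hC₂0
  have hleft : ∀ x, ∀ t ∈ Set.Iic x, ‖(Y x).1‖ * ‖(Z t).1‖ ≤ K * Real.exp (-(a * |x - t|)) := by
    intro x t ht
    rw [abs_of_nonneg (sub_nonneg.2 ht)]
    calc _ ≤ (C₁ * Real.exp (-a * x)) * (C₂ * Real.exp (a * t)) :=
          mul_le_mul (hC₁ x) (hC₂ t) (norm_nonneg _) (by positivity)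
      _ = K * (Real.exp (-a * x) * Real.exp (a * t)) := by rw [hK]; ring
      _ = _ := by rw [← Real.exp_add]; congr 2; ring
  have hright : ∀ x, ∀ t ∈ Set.Ioi x, ‖(Z x).1‖ * ‖(Y t).1‖ ≤ K * Real.exp (-(a * |x - t|)) := by
    intro x t ht
    rw [abs_of_nonpos (sub_nonpos.2 (le_of_lt ht))]
    calc _ ≤ (C₂ * Real.exp (a * x)) * (C₁ * Real.exp (-a * t)) :=
          mul_le_mul (hC₂ x) (hC₁ t) (norm_nonneg _) (by positivity)
      _ = K * (Real.exp (a * x) * Real.exp (-a * t)) := by rw [hK]; ring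
      _ = _ := by rw [← Real.exp_add]; congr 2; ring
  set k : ℝ → ENNReal := fun s => ENNReal.ofReal (K * Real.exp (-(a * |s|))) with hk
  have hkm : Measurable k := by rw [hk]; fun_prop
  set κ := ∫⁻ s, k s with hκ
  have hκtop : κ ≠ ⊤ := ((integrable_exp_neg_mul_abs ha).const_mul K).lintegral_lt_top.ne
  -- The factor 2 arises because each half of the Green's function is estimated by the convolution
  -- over the whole line.
  refine notMem_unboundedSpectrum (C := (2 * κ).toReal) (fun f => ?_) fun y hy => ?_
  · have hf : MemLp f 2 volume := Lp.memLp f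
    have hfm : Measurable fun t => ‖f t‖ₑ := (Lp.stronglyMeasurable f).measurable.enorm
    have hAint : ∀ x, IntegrableOn (fun t => (Z t).1 * f t) (Set.Iic x) := fun x =>
      integrableOn_mul_of_exp_bound (K := C₂ * Real.exp (a * x)) (x := x) ha measurableSet_Iic
        hZ.continuous.fst hf fun t ht => by
          rw [abs_of_nonneg (sub_nonneg.2 ht), mul_assoc, ← Real.exp_add]
          refine (hC₂ t).trans (le_of_eq ?_)
          congr 2
          ring
    have hBint : ∀ x, IntegrableOn (fun t => (Y t).1 * f t) (Set.Ioi x) := fun x =>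
      integrableOn_mul_of_exp_bound (K := C₁ * Real.exp (-a * x)) (x := x) ha measurableSet_Ioi
        hY.continuous.fst hf fun t ht => by
          rw [abs_of_nonpos (sub_nonpos.2 (le_of_lt ht)), mul_assoc, ← Real.exp_add]
          refine (hC₁ t).trans (le_of_eq ?_)
          congr 2
          ring
    set A : ℝ → ℂ := fun x => ∫ t in Set.Iic x, (Z t).1 * f t with hA
    set B : ℝ → ℂ := fun x => ∫ t in Set.Ioi x, (Y t).1 * f t with hB
    obtain ⟨v, hv1, hv2, hv3⟩ := hq.exists_hill_inhomogeneous hY hZ hW hf (A := A) (B := B)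
      (A₀ := A 0) (B₀ := B 0) (fun x => by
        rw [← intervalIntegral.integral_Iic_sub_Iic (hAint 0) (hAint x)]
        simp only [hA]
        ring) (fun x => by
        rw [intervalIntegral.integral_neg,
          ← intervalIntegral.integral_Ioi_sub_Ioi' (hBint 0) (hBint x)]
        simp only [hB]
        ring)
    set u : ℝ → ℂ := fun x => (Y x).1 * A x + (Z x).1 * B x with hu
    have hub : ∀ x, ‖u x‖ₑ ≤ 2 * ∫⁻ t, k (x - t) * ‖f t‖ₑ := fun x => by
      refine (enorm_add_le _ _).trans ?_
      rw [two_mul]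
      exact add_le_add (enorm_mul_setIntegral_le measurableSet_Iic (hleft x))
        (enorm_mul_setIntegral_le measurableSet_Ioi (hright x))
    have huL : eLpNorm u 2 volume ≤ (2 * κ) * eLpNorm f 2 volume := by
      refine eLpNorm_two_le_of_lintegral ?_
      calc ∫⁻ x, ‖u x‖ₑ ^ 2 ≤ ∫⁻ x, 2 ^ 2 * (∫⁻ t, k (x - t) * ‖f t‖ₑ) ^ 2 := by
            refine lintegral_mono fun x => ?_
            rw [← mul_pow]
            exact pow_le_pow_left' (hub x) 2
        _ = 2 ^ 2 * ∫⁻ x, (∫⁻ t, k (x - t) * ‖f t‖ₑ) ^ 2 :=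
            lintegral_const_mul' _ _ (by norm_num)
        _ ≤ 2 ^ 2 * (κ ^ 2 * ∫⁻ t, ‖f t‖ₑ ^ 2) := by
            gcongr
            exact lintegral_sq_convolution_le hkm hfm
        _ = _ := by rw [mul_pow, mul_assoc]
    have hκ2 : 2 * κ ≠ ⊤ := ENNReal.mul_ne_top (by norm_num) hκtop
    have huc : Continuous u := continuous_iff_continuousAt.2 fun x => (hv1 x).continuousAt
    have hum : MemLp u 2 volume := ⟨huc.aestronglyMeasurable,
      huL.trans_lt (ENNReal.mul_lt_top hκ2.lt_top hf.2)⟩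
    refine ⟨hum.toLp u, ⟨u, v, hum.coeFn_toLp, hv1, hv2, ?_⟩, ?_⟩
    · filter_upwards [hv3, Lp.coeFn_add f (z • hum.toLp u), Lp.coeFn_smul z (hum.toLp u),
        hum.coeFn_toLp] with x h1 h2 h3 h4
      rw [h2, Pi.add_apply, h3, Pi.smul_apply, h4, smul_eq_mul]
      exact h1
    · rw [Lp.norm_toLp, Lp.norm_def, ← ENNReal.toReal_mul]
      exact ENNReal.toReal_mono (ENNReal.mul_ne_top hκ2 hf.2.ne) huL
  · obtain ⟨u, v, h1, h2, h3, h4⟩ := hy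
    have hX := hq.isHillSolution_of_hasDerivAt (z := z) h2 h3 (by
      filter_upwards [h4, h1, Lp.coeFn_smul z y] with x hx hx1 hx2
      have hx1' : (y : ℝ → ℂ) x = u x := hx1
      have hx' : HasDerivAt v (q x * u x - ((z • y : L2R) : ℝ → ℂ) x) x := hx
      rw [hx2, Pi.smul_apply, hx1', smul_eq_mul] at hx'
      exact hx')
    have h0 := hq.eq_zero_of_memLp hX ((memLp_congr_ae h1).1 (Lp.memLp y)) hρ hlt.ne
    have hzero : IsHillSolution q z fun _ => (0 : ℂ × ℂ) := fun x => by
      rw [map_zero]; exact hasDerivAt_const x _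
    have h5 := hq.solution_unique hX hzero (x := 0) h0
    refine Lp.ext (h1.trans ?_)
    filter_upwards [Lp.coeFn_zero ℂ 2 (volume : Measure ℝ)] with x hx
    rw [hx]
    exact congrArg Prod.fst (congrFun h5 x)

/-! ### The real part of the spectrum -/

namespace HillPotential

variable {q : ℝ → ℂ}

theorem hillDiscriminant_eq_re (hq : HillPotential q) (r : ℝ) :
    hillDiscriminant q r = ((hillDiscriminant q r).re : ℂ) :=
  Complex.ext rfl (by rw [hq.hillDiscriminant_im, Complex.ofReal_im])

theorem mem_realSpectrum_of_abs_le (hq : HillPotential q) {r : ℝ}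
    (h : |(hillDiscriminant q r).re| ≤ 2) : r ∈ realSpectrum q := by
  set F := (hillDiscriminant q r).re with hF
  have h4 : 0 ≤ 1 - (F / 2) ^ 2 := by
    rw [sub_nonneg, sq_le_one_iff_abs_le_one, abs_div, abs_two]
    linarith
  set s := Real.sqrt (1 - (F / 2) ^ 2) with hs
  have hs2 : s ^ 2 = 1 - (F / 2) ^ 2 := Real.sq_sqrt h4
  have hs2' : (s : ℂ) ^ 2 = 1 - ((F : ℂ) / 2) ^ 2 := by
    rw [← Complex.ofReal_pow, hs2]; push_cast; ring
  obtain ⟨Y, hY, h0, hper⟩ := hq.exists_floquet (z := r) (ρ := (F / 2 : ℝ) + s * Complex.I) (by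
    rw [hq.hillDiscriminant_eq_re, ← hF]
    push_cast
    linear_combination (s : ℂ) ^ 2 * Complex.I_sq - hs2')
  refine hq.mem_spectrum_of_unimodular hY h0 hper ?_
  rw [← sq_eq_sq₀ (norm_nonneg _) zero_le_one, Complex.sq_norm, Complex.normSq_add_mul_I, hs2]
  ring

theorem notMem_realSpectrum_of_lt_abs (hq : HillPotential q) {r : ℝ}
    (h : 2 < |(hillDiscriminant q r).re|) : r ∉ realSpectrum q := by
  set F := (hillDiscriminant q r).re with hF
  have h4 : 0 ≤ (F / 2) ^ 2 - 1 := by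
    rw [sub_nonneg, one_le_sq_iff_one_le_abs, abs_div, abs_two]
    linarith
  set s := Real.sqrt ((F / 2) ^ 2 - 1) with hs
  have hs2 : s ^ 2 = (F / 2) ^ 2 - 1 := Real.sq_sqrt h4
  have hs0 : 0 ≤ s := Real.sqrt_nonneg _
  -- The roots are real with product 1; the one nearer to zero is taken, according to the sign of
  -- `F`.
  obtain ⟨ρ, hρ, hρ1⟩ : ∃ ρ : ℝ, ρ ^ 2 - F * ρ + 1 = 0 ∧ |ρ| < 1 := by
    rcases lt_abs.1 h with h | h
    · exact ⟨F / 2 - s, by linear_combination hs2, by rw [abs_lt]; constructor <;> nlinarith⟩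
    · exact ⟨F / 2 + s, by linear_combination hs2, by rw [abs_lt]; constructor <;> nlinarith⟩
  refine hq.notMem_spectrum_of_multiplier (ρ := ρ) ?_ (by simpa using hρ1)
  rw [hq.hillDiscriminant_eq_re, ← hF]
  exact_mod_cast hρ

theorem realSpectrum_compl (hq : HillPotential q) :
    (realSpectrum q)ᶜ = {r : ℝ | 2 < |(hillDiscriminant q r).re|} := by
  ext r
  constructor
  · intro h
    by_contra hcon
    exact h (hq.mem_realSpectrum_of_abs_le (not_lt.1 hcon))
  · exact fun h => hq.notMem_realSpectrum_of_lt_abs h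

theorem continuous_re_hillDiscriminant (hq : HillPotential q) :
    Continuous fun r : ℝ => (hillDiscriminant q r).re :=
  Complex.continuous_re.comp (hq.continuous_hillDiscriminant.comp Complex.continuous_ofReal)

theorem isBlochEigenvalue_zero (hq : HillPotential q) {r : ℝ}
    (h : (hillDiscriminant q r).re = 2) : IsBlochEigenvalue q 0 r := by
  refine hq.isBlochEigenvalue ?_
  rw [hq.hillDiscriminant_eq_re, h]
  norm_num

theorem isBlochEigenvalue_pi (hq : HillPotential q) {r : ℝ}
    (h : (hillDiscriminant q r).re = -2) : IsBlochEigenvalue q Real.pi r := by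
  refine hq.isBlochEigenvalue ?_
  rw [hq.hillDiscriminant_eq_re, h, mul_comm, Complex.exp_pi_mul_I]
  norm_num

/-- Only the sign of the discriminant at `n²` is needed, so an error `4N/n` below 2 suffices. -/
theorem abs_re_hillDiscriminant_sub_le (hq : HillPotential q) {n : ℕ} (hn : 0 < n)
    (hnN : 2 * (∫ t in (0 : ℝ)..Real.pi, ‖q t‖) < n) :
    |(hillDiscriminant q ((n : ℝ) ^ 2 : ℝ)).re - 2 * (-1) ^ n| < 2 := by
  have hn' : (0 : ℝ) < n := Nat.cast_pos.2 hn
  have h1 := hq.norm_hillDiscriminant_sub_le hn' hnN.le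
  rw [Real.cos_nat_mul_pi] at h1
  have h2 := (Complex.abs_re_le_norm _).trans h1
  rw [Complex.sub_re, Complex.ofReal_re] at h2
  refine h2.trans_lt ?_
  rw [div_lt_iff₀ hn']
  linarith

/-- If the discriminant does not take the values `±2` far to the right, then its values there lie
strictly between them. -/
theorem abs_re_hillDiscriminant_lt (hq : HillPotential q) {R : ℝ}
    (h : ∀ r : ℝ, R ≤ r → (hillDiscriminant q r).re ≠ 2 ∧ (hillDiscriminant q r).re ≠ -2)
    {r : ℝ} (hr : R ≤ r) : |(hillDiscriminant q r).re| < 2 := by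
  set F : ℝ → ℝ := fun r => (hillDiscriminant q r).re with hF
  have hc : ContinuousOn F (Set.Ici R) := hq.continuous_re_hillDiscriminant.continuousOn
  obtain ⟨n, hn⟩ := exists_nat_gt (max (2 * ∫ t in (0 : ℝ)..Real.pi, ‖q t‖) (max R 1))
  have hn1 : (1 : ℝ) < n := (le_max_right _ _).trans_lt ((le_max_right _ _).trans_lt hn)
  have hnR : R < n := (le_max_left _ _).trans_lt ((le_max_right _ _).trans_lt hn)
  have hnN : 2 * (∫ t in (0 : ℝ)..Real.pi, ‖q t‖) < n := (le_max_left _ _).trans_lt hn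
  have hmem : ∀ m : ℕ, n ≤ m → ((m : ℝ) ^ 2) ∈ Set.Ici R ∧ |F ((m : ℝ) ^ 2) - 2 * (-1) ^ m| < 2 := by
    intro m hm
    have hm' : (n : ℝ) ≤ m := Nat.cast_le.2 hm
    refine ⟨?_, hq.abs_re_hillDiscriminant_sub_le ?_ (hnN.trans_le hm')⟩
    · simp only [Set.mem_Ici]
      nlinarith
    · exact_mod_cast zero_lt_one.trans (hn1.trans_le hm')
  -- The value at the even square is positive, hence above `-2`; the value at the odd square is
  -- negative, hence below `2`. Each rules out one sign by the intermediate value theorem.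
  obtain ⟨e1, e2⟩ := hmem (2 * n) (by omega)
  obtain ⟨o1, o2⟩ := hmem (2 * n + 1) (by omega)
  rw [pow_mul (-1 : ℝ), neg_one_sq, one_pow, abs_lt] at e2
  rw [pow_succ (-1 : ℝ) (2 * n), pow_mul (-1 : ℝ), neg_one_sq, one_pow, abs_lt] at o2
  rw [abs_lt]
  constructor
  · by_contra hcon
    obtain ⟨s, hs, hs2⟩ := isPreconnected_Ici.intermediate_value (Set.mem_Ici.2 hr) e1 hc
      (show (-2 : ℝ) ∈ Set.Icc _ _ from ⟨not_lt.1 hcon, by linarith [e2.1]⟩)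
    exact (h s hs).2 hs2
  · by_contra hcon
    obtain ⟨s, hs, hs2⟩ := isPreconnected_Ici.intermediate_value o1 (Set.mem_Ici.2 hr) hc
      (show (2 : ℝ) ∈ Set.Icc _ _ from ⟨by linarith [o2.2], not_lt.1 hcon⟩)
    exact (h s hs).1 hs2

end HillPotential

/-! ### Finiteness of the set of gaps -/

/-- The supremum of a bounded component of an open set of reals is not in the open set. -/
theorem csSup_connectedComponentIn_notMem {U : Set ℝ} (hU : IsOpen U) {x : ℝ} (hx : x ∈ U)
    (hb : BddAbove (connectedComponentIn U x)) : sSup (connectedComponentIn U x) ∉ U := by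
  intro hs
  set G := connectedComponentIn U x with hG
  have hxG : x ∈ G := mem_connectedComponentIn hx
  obtain ⟨ε, hε, hball⟩ := Metric.isOpen_iff.1 hU _ hs
  obtain ⟨g, hgG, hg⟩ := exists_lt_of_lt_csSup ⟨x, hxG⟩ (sub_lt_self (sSup G) hε)
  have hgs : g ≤ sSup G := le_csSup hb hgG
  rw [Real.ball_eq_Ioo] at hball
  have hpre : IsPreconnected (G ∪ Set.Ioo (sSup G - ε) (sSup G + ε)) :=
    isPreconnected_connectedComponentIn.union g hgG ⟨hg, by linarith⟩ isPreconnected_Ioo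
  have hsub := hpre.subset_connectedComponentIn (Or.inl hxG)
    (Set.union_subset (connectedComponentIn_subset U x) hball)
  have hmem : sSup G + ε / 2 ∈ G := hsub (Or.inr ⟨by linarith, by linarith⟩)
  linarith [le_csSup hb hmem]

/-- The larger base point lies strictly below the common supremum, so order-connectedness puts it in
the other component. -/
theorem connectedComponentIn_eq_of_csSup_eq {U : Set ℝ} (hU : IsOpen U) {x y : ℝ} (hx : x ∈ U)
    (hy : y ∈ U) (hbx : BddAbove (connectedComponentIn U x))
    (hby : BddAbove (connectedComponentIn U y))
    (h : sSup (connectedComponentIn U x) = sSup (connectedComponentIn U y)) :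
    connectedComponentIn U x = connectedComponentIn U y := by
  wlog hxy : x ≤ y generalizing x y
  · exact (this hy hx hby hbx h.symm (le_of_not_ge hxy)).symm
  have hyG := mem_connectedComponentIn hy
  have hlt : y < sSup (connectedComponentIn U x) := by
    rw [h]
    refine lt_of_le_of_ne (le_csSup hby hyG) fun he => ?_
    exact csSup_connectedComponentIn_notMem hU hy hby (he ▸ hy)
  obtain ⟨g, hg, hyg⟩ := exists_lt_of_lt_csSup ⟨x, mem_connectedComponentIn hx⟩ hlt
  refine connectedComponentIn_eq ?_
  exact isPreconnected_connectedComponentIn.ordConnected.out (mem_connectedComponentIn hx) hg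
    ⟨hxy, hyg.le⟩

/-- A superlevel set which is bounded above has finitely many components if the level is attained
at finitely many points. -/
theorem finite_gaps_of_finite_level {S : Set ℝ} {g : ℝ → ℝ} (hg : Continuous g) {c : ℝ}
    (hS : Sᶜ = {x | c < g x}) (hfin : {x | g x = c}.Finite) (hb : BddAbove Sᶜ) :
    (gaps S).Finite := by
  have hU : IsOpen Sᶜ := by rw [hS]; exact isOpen_lt continuous_const hg
  have hbdd : ∀ x, BddAbove (connectedComponentIn Sᶜ x) := fun x =>
    hb.mono (connectedComponentIn_subset _ _)
  -- The supremum maps the gaps injectively into the finite level set.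
  refine Set.Finite.of_finite_image (f := sSup) (hfin.subset ?_) ?_
  · rintro _ ⟨_, ⟨x, hx, rfl⟩, rfl⟩
    have h1 : ¬ c < g (sSup (connectedComponentIn Sᶜ x)) := fun h =>
      csSup_connectedComponentIn_notMem hU hx (hbdd x) (hS.symm.subset h)
    refine le_antisymm (not_lt.1 h1) ?_
    have h2 : closure (connectedComponentIn Sᶜ x) ⊆ {x | c ≤ g x} :=
      (isClosed_le continuous_const hg).closure_subset_iff.2
        ((connectedComponentIn_subset _ _).trans (by
          rw [hS]; exact fun y (hy : c < g y) => hy.le))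
    exact h2 (csSup_mem_closure ⟨x, mem_connectedComponentIn hx⟩ (hbdd x))
  · rintro _ ⟨x, hx, rfl⟩ _ ⟨y, hy, rfl⟩ h
    exact connectedComponentIn_eq_of_csSup_eq hU hx hy (hbdd x) (hbdd y) h

theorem finite_real_of_eventually_nonreal {μ : ℕ → ℂ} {m : ℕ} (h : ∀ n, m < n → (μ n).im ≠ 0) :
    {x : ℝ | ∃ n, 1 ≤ n ∧ μ n = x}.Finite := by
  refine ((Set.finite_Iic m).image fun n => (μ n).re).subset ?_
  rintro x ⟨n, -, hn⟩
  refine ⟨n, not_lt.1 fun hmn => h n hmn (by rw [hn, Complex.ofReal_im]), ?_⟩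
  simp only [hn, Complex.ofReal_re]

end

/-! ### The main theorem -/

theorem theorem9 (q : ℝ → ℂ)
    (hq_int : MeasureTheory.IntegrableOn q (Set.Icc 0 Real.pi))
    (hq_mean : ∫ x in (0 : ℝ)..Real.pi, q x = 0)
    (hq_per : ∀ᵐ x : ℝ, q (x + Real.pi) = q x)
    (hq_PT : ∀ᵐ x : ℝ, (starRingEnd ℂ) (q (-x)) = q x)
    -- `μ 1 0, μ 2 0, …` list the periodic, `μ 1 π, μ 2 π, …` the antiperiodic eigenvalues
    -- (in any order; repetitions, for instance according to multiplicity, are allowed)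
    (μ : ℕ → ℝ → ℂ)
    (hμ_per : {z : ℂ | IsBlochEigenvalue q 0 z} = {z : ℂ | ∃ n : ℕ, 1 ≤ n ∧ μ n 0 = z})
    (hμ_anti : {z : ℂ | IsBlochEigenvalue q Real.pi z} =
      {z : ℂ | ∃ n : ℕ, 1 ≤ n ∧ μ n Real.pi = z})
    (hnonreal : ∃ m : ℕ, 0 < m ∧ ∀ n : ℕ, m < n →
      (μ n 0).im ≠ 0 ∧ (μ n Real.pi).im ≠ 0) :
    (∃ R : ℝ, ∀ x : ℝ, R ≤ x → (x : ℂ) ∈ unboundedSpectrum (hillOperator q)) ∧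
      (gaps (realSpectrum q)).Finite := by
  have hq : HillPotential q :=
    ⟨intervalIntegrable_of_ae_periodic Real.pi_pos hq_int hq_per, hq_mean, hq_per, hq_PT⟩
  obtain ⟨m, -, hm⟩ := hnonreal
  have hfin : {r : ℝ | |(hillDiscriminant q r).re| = 2}.Finite := by
    refine ((finite_real_of_eventually_nonreal fun n hn => (hm n hn).1).union
      (finite_real_of_eventually_nonreal fun n hn => (hm n hn).2)).subset fun r hr => ?_
    rcases eq_or_eq_neg_of_abs_eq hr with h | h
    · exact Or.inl (hμ_per.subset (hq.isBlochEigenvalue_zero h))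
    · exact Or.inr (hμ_anti.subset (hq.isBlochEigenvalue_pi h))
  obtain ⟨R, hR⟩ := hfin.bddAbove
  -- The level `2` may be attained at `R` itself, so the half-line starts at `R + 1`.
  have hlt : ∀ r : ℝ, R + 1 ≤ r → |(hillDiscriminant q r).re| < 2 := fun r hr => by
    refine hq.abs_re_hillDiscriminant_lt (R := R + 1) (fun s hs => ?_) hr
    rw [← not_or]
    intro hcon
    have hs' : |(hillDiscriminant q s).re| = 2 := by
      rcases hcon with h | h <;> simp [h]
    linarith [hR hs']
  refine ⟨⟨R + 1, fun x hx => hq.mem_realSpectrum_of_abs_le (hlt x hx).le⟩, ?_⟩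
  refine finite_gaps_of_finite_level hq.continuous_re_hillDiscriminant.abs hq.realSpectrum_compl
    hfin ⟨R + 1, fun x hx => ?_⟩
  rw [hq.realSpectrum_compl] at hx
  by_contra hcon
  exact absurd (hlt x (le_of_not_ge hcon)) (not_lt.2 (le_of_lt hx))
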